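/- Let $d\ge 2$ and, on the real Hilbert space $\bigoplus_{j=1}^d\ell^2(\mathbb Z^d)$ with $\langle w,w'\rangle=\sum_i\sum_x w_i(x)w_i'(x)$, put $(\partial_i\phi)(x)=\phi(x+e_i)-\phi(x)$, $(\partial_i^*\phi)(x)=\phi(x-e_i)-\phi(x)$, $-\Delta=\sum_i\partial_i^*\partial_i$ and $$(Q_dw)_i=-\Delta w_i-\sum_{j=1}^d\partial_i\partial_j^*w_j,\qquad 1\le i\le d.$$ For $n\in\mathbb N$ let $\Lambda_n=\{0,\dots,n\}^d$ and $\partial\Lambda_n=\{x\in\Lambda_n: x_i\in\{0,n\}\text{ for some }i\}$. Let $E_n$ be the set of edges $(x,x+e_i)$ with $x,x+e_i\in\Lambda_n$, let $E_n^0\subset E_n$ be the set of those edges $(x,x+e_j)$ with $x_{j+1}=\dots=x_d=0$, and let $E_n^1=E_n\setminus E_n^0$. For $u\in\mathbb R^{E_n}$ and a plaquette $p=(x,j,k)$, $j<k$, with $x,\,x+e_j,\,x+e_j+e_k,\,x+e_k\in\Lambda_n$, put $u_p=u_{(x,x+e_j)}+u_{(x+e_j,x+e_j+e_k)}-u_{(x+e_k,x+e_j+e_k)}-u_{(x,x+e_k)}$.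 Let $\Sigma_n(u,v)=\sum_pu_pv_p$, and let $\Sigma_n^0$ be the symmetric matrix of the restriction of $\Sigma_n$ to $\mathbb R^{E_n^1}=\{u\in\mathbb R^{E_n}:u_e=0\ \forall e\in E_n^0\}$. Let $\Omega_n^{1,a}\subset\bigoplus_{j=1}^d\ell^2(\mathbb Z^d)$ be the space of all $w$ that vanish outside $\Lambda_n$ and satisfy $w_i=0$ on $$V^0_{n,i}=\{x\in\Lambda_n:(x,x+e_i)\in E_n^0\}\cup\{x\in\partial\Lambda_n:(x,x+e_i)\notin E_n\}$$ for all $i$, and let $\Pi_n$ be the orthogonal projection onto $\Omega_n^{1,a}$; view $\Pi_nQ_d\Pi_n$ as an operator on $\Omega_n^{1,a}$. Then the following hold. 1. $Q_d$ defines a non-negative symmetric quadratic form, and $\langle w,Q_dw\rangle=\frac12\sum_{i,j=1}^d\|\partial_iw_j-\partial_jw_i\|^2$ for all $w\in\bigoplus_{j=1}^d\ell^2(\mathbb Z^d)$. 2. For every $n$, $\Sigma_n^0$ and $\Pi_nQ_d\Pi_n$ (on $\Omega_n^{1,a}$) are positive definite, the limit $K_d:=\lim_{n\to\infty}-\frac1{2n^d}\operatorname{tr}\log\Sigma_n^0$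 exists in $\mathbb R$, and $$K_d=\lim_{n\to\infty}-\frac1{2n^d}\operatorname{tr}\log(\Pi_nQ_d\Pi_n),$$ where the trace is over $\Omega_n^{1,a}$. 3. The two integrals below converge absolutely, and $$K_d=-\frac{d-1}2\log2-\frac12\int_0^1\log(1-\cos2\pi x)\,dx-\frac{d-2}2\int_{[0,1]^d}\log\sum_{k=1}^d(1-\cos2\pi x_k)\,dx.$$ -/

import Mathlib

namespace LatticeMaxwell

/-! ### The lattice `ℤ^d`, the real Hilbert space `⨁_{j=1}^d ℓ²(ℤ^d)` and lattice derivatives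

The directions `1, …, d` are indexed by `Fin d`, i.e. by `0, …, d - 1`. -/

/-- The lattice `ℤ^d`. -/
abbrev Site (d : ℕ) : Type := Fin d → ℤ

/-- The canonical basis vector `e_i`. -/
def unit {d : ℕ} (i : Fin d) : Site d := Pi.single i 1

/-- The real Hilbert space `ℓ²(ℤ^d)`. -/
abbrev L2 (d : ℕ) : Type := lp (fun _ : Site d => ℝ) 2

/-- The real Hilbert space `⨁_{j=1}^d ℓ²(ℤ^d)` with `⟨w, w'⟩ = ∑ i, ⟨w_i, w'_i⟩`. -/
abbrev Fields (d : ℕ) : Type := PiLp 2 (fun _ : Fin d => L2 d)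

theorem memlp_shift {d : ℕ} (v : Site d) (φ : L2 d) :
    Memℓp (fun x : Site d => φ (x + v)) 2 := by
  have h := (memℓp_gen_iff (p := 2) (by norm_num)).1 (lp.memℓp φ)
  refine (memℓp_gen_iff (p := 2) (by norm_num)).2 ?_
  exact h.comp_injective (add_left_injective v)

/-- The translation `(τ_v φ)(x) = φ(x + v)` of `ℓ²(ℤ^d)`. -/
noncomputable def shift {d : ℕ} (v : Site d) : L2 d →ₗᵢ[ℝ] L2 d where
  toFun φ := ⟨fun x => φ (x + v), memlp_shift v φ⟩
  map_add' _ _ := rfl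
  map_smul' _ _ := rfl
  norm_map' φ := by
    rw [lp.norm_eq_tsum_rpow (by norm_num), lp.norm_eq_tsum_rpow (by norm_num)]
    congr 1
    exact (Equiv.addRight v).tsum_eq (fun x => ‖φ x‖ ^ (2 : ENNReal).toReal)

/-- The forward derivative `(∂_i φ)(x) = φ(x + e_i) - φ(x)`. -/
noncomputable def partialD {d : ℕ} (i : Fin d) : L2 d →L[ℝ] L2 d :=
  (shift (unit i)).toContinuousLinearMap - ContinuousLinearMap.id ℝ (L2 d)

/-- The backward derivative `(∂_i^* φ)(x) = φ(x - e_i) - φ(x)`. -/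
noncomputable def partialStar {d : ℕ} (i : Fin d) : L2 d →L[ℝ] L2 d :=
  (shift (-unit i)).toContinuousLinearMap - ContinuousLinearMap.id ℝ (L2 d)

/-- The operator `-Δ = ∑_i ∂_i^* ∂_i`. -/
noncomputable def negLaplacian (d : ℕ) : L2 d →L[ℝ] L2 d :=
  ∑ i : Fin d, (partialStar i).comp (partialD i)

/-- The operator `(Q_d w)_i = -Δ w_i - ∑_j ∂_i ∂_j^* w_j` on `⨁_{j=1}^d ℓ²(ℤ^d)`. -/
noncomputable def Q (d : ℕ) : Fields d →L[ℝ] Fields d :=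
  (PiLp.continuousLinearEquiv 2 ℝ (fun _ : Fin d => L2 d)).symm.toContinuousLinearMap.comp
    (ContinuousLinearMap.pi fun i : Fin d =>
      (negLaplacian d).comp (PiLp.proj 2 (fun _ : Fin d => L2 d) i) -
        ∑ j : Fin d, ((partialD i).comp (partialStar j)).comp
          (PiLp.proj 2 (fun _ : Fin d => L2 d) j))

/-! ### The box `Λ_n = {0, …, n}^d`, its edges, the axial gauge tree and its plaquettes -/

/-- The box `Λ_n = {0, …, n}^d`. -/
noncomputable def box (d n : ℕ) : Finset (Site d) := Fintype.piFinset fun _ => Finset.Icc 0 (n : ℤ)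

/-- The boundary `∂Λ_n = ∂[0,n]^d ∩ ℤ^d`. -/
noncomputable def boundary (d n : ℕ) : Finset (Site d) :=
  (box d n).filter fun x => ∃ i, x i = 0 ∨ x i = (n : ℤ)

/-- The edges `E_n` of `Λ_n`; the positively oriented edge `(x, x + e_i)` of `ℤ^d` is encoded by
the pair `(x, i)`. -/
noncomputable def edges (d n : ℕ) : Finset (Site d × Fin d) :=
  (box d n ×ˢ Finset.univ).filter fun e => e.1 + unit e.2 ∈ box d n

/-- The edges `E_n^0` of the maximal tree: those `(x, x + e_j)` in `E_n` with
`x = (x_1, …, x_j, 0, …, 0)`. -/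
noncomputable def treeEdges (d n : ℕ) : Finset (Site d × Fin d) :=
  (edges d n).filter fun e => ∀ k, e.2 < k → e.1 k = 0

/-- The edges `E_n^1 = E_n \ E_n^0`. -/
noncomputable def axialEdges (d n : ℕ) : Finset (Site d × Fin d) := edges d n \ treeEdges d n

/-- The plaquettes `P_n`: triples `(x, j, k)` with `j < k` such that all of
`x, x + e_j, x + e_j + e_k, x + e_k` lie in `Λ_n`. -/
noncomputable def plaquettes (d n : ℕ) : Finset (Site d × Fin d × Fin d) :=
  (box d n ×ˢ Finset.univ).filter fun p =>
    p.2.1 < p.2.2 ∧ p.1 + unit p.2.1 ∈ box d n ∧ p.1 + unit p.2.1 + unit p.2.2 ∈ box d n ∧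
      p.1 + unit p.2.2 ∈ box d n

/-! ### The quadratic form of lattice Maxwell theory -/

/-- For `p = (x, j, k)`, the value
`u_p = u_{(x,x+e_j)} + u_{(x+e_j,x+e_j+e_k)} - u_{(x+e_k,x+e_j+e_k)} - u_{(x,x+e_k)}`. -/
def plaquetteValue {d : ℕ} (u : Site d × Fin d → ℝ) (p : Site d × Fin d × Fin d) : ℝ :=
  u (p.1, p.2.1) + u (p.1 + unit p.2.1, p.2.2) - u (p.1 + unit p.2.2, p.2.1) - u (p.1, p.2.2)

/-- The form `Σ_n(u, v) = ∑_{p ∈ P_n} u_p v_p`. Elements of `ℝ^{E_n}` are regarded as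
functions on all edges of `ℤ^d` that vanish outside `E_n`. -/
noncomputable def sigmaForm (d n : ℕ) (u v : Site d × Fin d → ℝ) : ℝ :=
  ∑ p ∈ plaquettes d n, plaquetteValue u p * plaquetteValue v p

/-- The matrix `Σ_n^0`, in the standard basis, of the restriction of `Σ_n` to
`ℝ^{E_n^1} = {u : u_e = 0 for e ∈ E_n^0}`. -/
noncomputable def sigmaZero (d n : ℕ) : Matrix (axialEdges d n) (axialEdges d n) ℝ :=
  Matrix.of fun e e' => sigmaForm d n (Pi.single e.1 1) (Pi.single e'.1 1)

/-! ### The axial gauge space -/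

/-- The set `V_{n,i}^0` of sites at which the `i`-th component of the field has to vanish. -/
noncomputable def constrainedSites (d n : ℕ) (i : Fin d) : Finset (Site d) :=
  ((box d n).filter fun x => (x, i) ∈ treeEdges d n) ∪
    ((boundary d n).filter fun x => (x, i) ∉ edges d n)

/-- The axial gauge space `Ω_n^{1,a}`: the fields on `Λ_n`, extended by zero to `ℤ^d`, whose
`i`-th component vanishes on `V_{n,i}^0` for every `i`. -/
def axialSpace (d n : ℕ) : Submodule ℝ (Fields d) where
  carrier := {w | ∀ i : Fin d,
    (∀ x, x ∉ box d n → w i x = 0) ∧ ∀ x ∈ constrainedSites d n i, w i x = 0}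
  zero_mem' := fun _ => ⟨fun _ _ => rfl, fun _ _ => rfl⟩
  add_mem' := by
    intro v w hv hw i
    refine ⟨fun x hx => ?_, fun x hx => ?_⟩
    · simp [(hv i).1 x hx, (hw i).1 x hx]
    · simp [(hv i).2 x hx, (hw i).2 x hx]
  smul_mem' := by
    intro c w hw i
    refine ⟨fun x hx => ?_, fun x hx => ?_⟩
    · simp [(hw i).1 x hx]
    · simp [(hw i).2 x hx]

instance (d n : ℕ) : FiniteDimensional ℝ (axialSpace d n) := by
  let f : axialSpace d n →ₗ[ℝ] (Fin d × box d n → ℝ) :=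
    { toFun := fun w p => w.1 p.1 p.2.1
      map_add' := fun _ _ => rfl
      map_smul' := fun _ _ => rfl }
  refine FiniteDimensional.of_injective f ?_
  intro v w h
  ext i x
  by_cases hx : x ∈ box d n
  · exact congrFun h (i, ⟨x, hx⟩)
  · exact ((v.2 i).1 x hx).trans ((w.2 i).1 x hx).symm

/-- The compression `Π_V A Π_V`, viewed as an operator from `ran Π_V = V` to itself, where
`Π_V` is the orthogonal projection onto `V`. -/
noncomputable def compression {E : Type*} [NormedAddCommGroup E] [InnerProductSpace ℝ E]
    (V : Submodule ℝ E) [V.HasOrthogonalProjection] (A : E →L[ℝ] E) : V →ₗ[ℝ] V :=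
  (V.orthogonalProjectionOnto.comp (A.comp V.subtypeL)).toLinearMap

/-! ### The trace of the logarithm -/

/-- The logarithm `log T = ∑_μ (log μ) P_μ` of a symmetric, positive definite operator `T` on a
finite dimensional real Hilbert space; the sum is over the distinct eigenvalues `μ` of `T`, and
`P_μ` is the orthogonal projection onto the eigenspace of `μ`. -/
noncomputable def logOp {E : Type*} [NormedAddCommGroup E] [InnerProductSpace ℝ E]
    [FiniteDimensional ℝ E] (T : E →ₗ[ℝ] E) : E →ₗ[ℝ] E :=
  ∑ μ : Module.End.Eigenvalues T,
    Real.log (μ : ℝ) • (Module.End.eigenspace T (μ : ℝ)).starProjection.toLinearMap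

/-- `tr log T`. -/
noncomputable def trLog {E : Type*} [NormedAddCommGroup E] [InnerProductSpace ℝ E]
    [FiniteDimensional ℝ E] (T : E →ₗ[ℝ] E) : ℝ :=
  LinearMap.trace ℝ E (logOp T)

/-! ### The constant `K_d` -/

/-- The sequence `-tr log Σ_n^0 / (2 n^d)`. -/
noncomputable def maxwellFreeEnergy (d n : ℕ) : ℝ :=
  -trLog (Matrix.toEuclideanLin (sigmaZero d n)) / (2 * (n : ℝ) ^ d)

/-- The constant `K_d = lim_{n → ∞} -tr log Σ_n^0 / (2 n^d)`. -/
noncomputable def K (d : ℕ) : ℝ := Filter.limUnder Filter.atTop (maxwellFreeEnergy d)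

end LatticeMaxwell

/-! Both operators are Gram matrices of plaquette values of fields supported on `axialEdges`. For
`sigmaZero` the plaquettes lie inside `Λ_n`. For the compression of `Q` they are all the plaquettes
of `ℤ^d` that meet `Λ_n`, because `Q` is the form of the curl and the fields are extended by zero.
As `tr log` is `log det`, it suffices to know these determinants up to a factor `exp(o(n^d))`, so
boundary conditions may be altered at will as long as each elementary change costs only a polynomial
factor in `n`.

The costs are controlled by a polynomial spectral gap. In the axial gauge every edge value is a sum
of at most `d * n` plaquette values (`abs_le_of_axial`), so the form is bounded below by an inverse
power of `n`. Adding a plaquette is a rank-one perturbation (`det_add_sum_vecMulVec_bounds`) and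
deleting an edge passes to a principal block (`det_toBlock_bounds`). Either way one step moves `log
det` by `O(log n)`, and only `O(n^(d-1))` steps are needed.

The edge set is thereby reduced to `refEdges`, which omits the last direction `o` and is
diagonalised almost completely by products of sines and cosines: component `j` is Neumann in
direction `j` and Dirichlet in the others, and lattice derivatives exchange the two types. In these
modes the operator is `D - G Gᵀ`, with `D` the diagonal symbol of `-Δ` and `G` the gradient. Since
`G` is sparse, `det (D - G Gᵀ) = det D * det (1 - Gᵀ D⁻¹ G)` has a diagonal second factor, and at an
interior frequency `1 - ∑_{i ≠ o} freq_i² / symbol = freq_o² / symbol` (`det_gram_refEdges`).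

Each of the `d - 1` remaining components thus contributes one integral of the logarithm of the
symbol, and the second factor removes one of them and adds a one-dimensional integral; this is the
origin of the coefficients `d - 2` and `1`. The sums over frequencies are Riemann sums of functions
with logarithmic singularities, handled by monotonicity and dominated convergence. Folding the unit
interval by the tent map replaces `cos (π x)` by `cos (2 π x)`. -/

namespace LatticeMaxwell

open Matrix

/-! ### Determinants under compression and under rank-one perturbation. -/

section LinearAlgebra

theorem trLog_eq_log_det {E : Type*} [NormedAddCommGroup E] [InnerProductSpace ℝ E]
    [FiniteDimensional ℝ E] (T : E →ₗ[ℝ] E) (hT : T.IsSymmetric)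
    (hpos : ∀ v, v ≠ 0 → 0 < inner ℝ v (T v)) : trLog T = Real.log (LinearMap.det T) := by
  classical
  have hn : Module.finrank ℝ E = Module.finrank ℝ E := rfl
  set b := hT.eigenvectorBasis hn
  set l := hT.eigenvalues hn
  have hb : ∀ i, T (b i) = l i • b i := fun i => hT.apply_eigenvectorBasis hn i
  have hb1 : ∀ i, inner ℝ (b i) (b i) = (1 : ℝ) := fun i => by
    simp
  have hl : ∀ i, l i ≠ 0 := by
    intro i
    have h := hpos (b i) (b.orthonormal.ne_zero i)
    rw [hb, inner_smul_right, hb1, mul_one] at h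
    exact h.ne'
  have hlog : ∀ i, logOp T (b i) = Real.log (l i) • b i := by
    intro i
    have hev : Module.End.HasEigenvalue T (l i) := by
      refine Module.End.hasEigenvalue_of_hasEigenvector (x := b i) ⟨?_, b.orthonormal.ne_zero i⟩
      rw [Module.End.mem_eigenspace_iff, hb]
    have hmem : b i ∈ Module.End.eigenspace T (l i) := by
      rw [Module.End.mem_eigenspace_iff, hb]
    rw [logOp, LinearMap.sum_apply]
    refine (Finset.sum_eq_single (⟨l i, hev⟩ : Module.End.Eigenvalues T) ?_ ?_).trans ?_
    rotate_left 2
    · rw [LinearMap.smul_apply]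
      congr 1
      exact (Submodule.starProjection_eq_self_iff).2 hmem
    -- Eigenspaces of distinct eigenvalues are orthogonal, so every other projection kills `b i`.
    · intro μ _ hμ
      have hne : (μ : ℝ) ≠ l i := fun h => hμ (Subtype.ext h)
      rw [LinearMap.smul_apply]
      have : (Module.End.eigenspace T (μ : ℝ)).starProjection (b i) = 0 := by
        rw [Submodule.starProjection_apply_eq_zero_iff, Submodule.mem_orthogonal]
        intro u hu
        exact hT.orthogonalFamily_eigenspaces hne ⟨u, hu⟩ ⟨b i, hmem⟩
      erw [this]
      simp
    · exact fun h => (h (@Finset.mem_univ _ (_) _)).elim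
  rw [trLog, LinearMap.trace_eq_sum_inner _ b, hT.det_eq_prod_eigenvalues hn]
  simp only [RCLike.ofReal_real_eq_id, id]
  rw [Real.log_prod (fun i _ => hl i)]
  refine Finset.sum_congr rfl fun i _ => ?_
  rw [hlog, inner_smul_right, hb1, mul_one]

variable {ι κ : Type*} [Fintype ι] [DecidableEq ι]

theorem trLog_toEuclideanLin {A : Matrix ι ι ℝ} (hA : A.PosDef) :
    trLog (Matrix.toEuclideanLin A) = Real.log A.det := by
  rw [trLog_eq_log_det]
  · congr 1
    rw [show Matrix.toEuclideanLin A = Matrix.toLin (PiLp.basisFun 2 ℝ ι) (PiLp.basisFun 2 ℝ ι) A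
      from by rw [← Matrix.toLpLin_eq_toLin]]
    rw [LinearMap.det_toLin]
  · exact Matrix.isSymmetric_toEuclideanLin_iff.2 hA.1
  · intro v hv
    have h := hA.dotProduct_mulVec_pos (x := v.ofLp) (by simpa using hv)
    rw [EuclideanSpace.inner_eq_star_dotProduct, dotProduct_comm]
    exact h

theorem isHermitian_of_sub_smul_one {ι : Type*} [DecidableEq ι] {M : Matrix ι ι ℝ} {c : ℝ}
    (h : (M - c • (1 : Matrix ι ι ℝ)).PosSemidef) : M.IsHermitian := by
  have := h.1.add (Matrix.isHermitian_one.smul (k := c) (by simp [IsSelfAdjoint]))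
  simpa using this

theorem posDef_of_sub_smul_one {ι : Type*} [DecidableEq ι] {M : Matrix ι ι ℝ} {c : ℝ} (hc : 0 < c)
    (h : (M - c • (1 : Matrix ι ι ℝ)).PosSemidef) : M.PosDef := by
  have := Matrix.PosDef.posSemidef_add h (Matrix.PosDef.one.smul hc)
  simpa using this

theorem mul_dotProduct_le {M : Matrix ι ι ℝ} {c : ℝ}
    (h : (M - c • (1 : Matrix ι ι ℝ)).PosSemidef) (x : ι → ℝ) :
    c * (x ⬝ᵥ x) ≤ x ⬝ᵥ (M *ᵥ x) := by
  have := h.dotProduct_mulVec_nonneg x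
  simp only [star_trivial, sub_mulVec, dotProduct_sub, smul_mulVec, one_mulVec,
    dotProduct_smul, smul_eq_mul] at this
  linarith

theorem pow_le_det {M : Matrix ι ι ℝ} {c : ℝ} (hc : 0 ≤ c)
    (h : (M - c • (1 : Matrix ι ι ℝ)).PosSemidef) : c ^ Fintype.card ι ≤ M.det := by
  have hM := isHermitian_of_sub_smul_one h
  rw [hM.det_eq_prod_eigenvalues, ← Finset.card_univ, ← Finset.prod_const]
  refine Finset.prod_le_prod (fun _ _ => hc) fun i _ => ?_
  have h1 := mul_dotProduct_le h (hM.eigenvectorBasis i).ofLp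
  have h2 : (hM.eigenvectorBasis i).ofLp ⬝ᵥ (hM.eigenvectorBasis i).ofLp = 1 := by
    have := EuclideanSpace.inner_eq_star_dotProduct (hM.eigenvectorBasis i) (hM.eigenvectorBasis i)
    rw [real_inner_self_eq_norm_sq] at this
    simpa using this.symm
  rw [h2] at h1
  have h3 := hM.eigenvalues_eq i
  simp only [star_trivial, RCLike.re_to_real] at h3
  simpa [h3] using h1

theorem det_le_pow {M : Matrix ι ι ℝ} {a : ℝ} (hM : M.PosSemidef)
    (h : (a • (1 : Matrix ι ι ℝ) - M).PosSemidef) : M.det ≤ a ^ Fintype.card ι := by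
  rw [hM.1.det_eq_prod_eigenvalues, ← Finset.card_univ, ← Finset.prod_const]
  refine Finset.prod_le_prod (fun i _ => hM.eigenvalues_nonneg i) fun i _ => ?_
  have h1 := h.dotProduct_mulVec_nonneg (hM.1.eigenvectorBasis i).ofLp
  have h2 : (hM.1.eigenvectorBasis i).ofLp ⬝ᵥ (hM.1.eigenvectorBasis i).ofLp = 1 := by
    have := EuclideanSpace.inner_eq_star_dotProduct (hM.1.eigenvectorBasis i)
      (hM.1.eigenvectorBasis i)
    rw [real_inner_self_eq_norm_sq] at this
    simpa using this.symm
  have h3 := hM.1.eigenvalues_eq i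
  simp only [star_trivial, RCLike.re_to_real] at h3
  simp only [star_trivial, sub_mulVec, dotProduct_sub, smul_mulVec, one_mulVec,
    dotProduct_smul, smul_eq_mul, h2, ← h3] at h1
  simpa using h1

/-- The quotient of the two determinants is the determinant of the Schur complement of the block,
and that complement inherits both spectral bounds of `A`. Each deleted index therefore costs a
factor between `c` and `a`. -/
theorem det_toBlock_bounds {A : Matrix ι ι ℝ} {a c : ℝ} (hc : 0 < c)
    (hlow : (A - c • (1 : Matrix ι ι ℝ)).PosSemidef)
    (hup : (a • (1 : Matrix ι ι ℝ) - A).PosSemidef) (p : ι → Prop) [DecidablePred p] :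
    0 < (A.toBlock p p).det ∧
    c ^ Fintype.card {i // ¬ p i} * (A.toBlock p p).det ≤ A.det ∧
    A.det ≤ a ^ Fintype.card {i // ¬ p i} * (A.toBlock p p).det := by
  have hA := posDef_of_sub_smul_one hc hlow
  have hW : (A.toBlock p p).PosDef := hA.submatrix Subtype.val_injective
  have hWpos := hW.det_pos
  set W := A.toBlock p p with hWdef
  set B := A.toBlock p (fun i => ¬ p i) with hB
  set D := A.toBlock (fun i => ¬ p i) (fun i => ¬ p i) with hD
  have hBH : A.toBlock (fun i => ¬ p i) p = Bᴴ := by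
    ext i j
    have := congrFun (congrFun hA.1 i.1) j.1
    simpa [hB, Matrix.toBlock] using this.symm
  let _ : Invertible W := W.invertibleOfIsUnitDet (isUnit_iff_ne_zero.2 hWpos.ne')
  have hdet : A.det = W.det * (D - Bᴴ * W⁻¹ * B).det := by
    rw [A.det_toBlock p, hBH, Matrix.det_fromBlocks₁₁, Matrix.invOf_eq_nonsing_inv]
  have hlow' : ((D - Bᴴ * W⁻¹ * B) - c • (1 : Matrix {i // ¬ p i} {i // ¬ p i} ℝ)).PosSemidef := by
    have key : (Matrix.fromBlocks W B Bᴴ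
        (D - c • (1 : Matrix {i // ¬ p i} {i // ¬ p i} ℝ))).PosSemidef := by
      -- Adding `c` back on the indices in `p` leaves `A` with `c` subtracted from the complementary
      -- block only. The Schur complement of that matrix is the one of `A` minus `c`.
      let q : Matrix ι ι ℝ := Matrix.diagonal fun i => if p i then c else 0
      have hq : q.PosSemidef := Matrix.PosSemidef.diagonal fun i => by
        by_cases h : p i <;> simp [h, hc.le]
      have hsum := (hlow.add hq).submatrix (Equiv.sumCompl p)
      convert hsum using 1
      ext i j
      rcases i with i | i <;> rcases j with j | j
      · by_cases hij : i = j
        · subst hij; simp [W, q, Matrix.toBlock, i.2]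
        · have : (i : ι) ≠ j := fun h => hij (Subtype.ext h)
          simp [W, q, Matrix.toBlock, this]
      · have : (i : ι) ≠ j := fun h => j.2 (h ▸ i.2)
        simp [B, q, Matrix.toBlock, this]
      · have : (i : ι) ≠ j := fun h => i.2 (h ▸ j.2)
        rw [← hBH]
        simp [q, Matrix.toBlock, this]
      · by_cases hij : i = j
        · subst hij; simp [D, q, Matrix.toBlock, i.2]
        · have : (i : ι) ≠ j := fun h => hij (Subtype.ext h)
          simp [D, q, Matrix.toBlock, this, hij]
    have := (Matrix.PosDef.fromBlocks₁₁ B _ hW).1 key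
    rwa [sub_right_comm] at this
  have hS : (D - Bᴴ * W⁻¹ * B).PosSemidef := (posDef_of_sub_smul_one hc hlow').posSemidef
  have hup' : (a • (1 : Matrix {i // ¬ p i} {i // ¬ p i} ℝ) - (D - Bᴴ * W⁻¹ * B)).PosSemidef := by
    have h1 : (a • (1 : Matrix {i // ¬ p i} {i // ¬ p i} ℝ) - D).PosSemidef := by
      have := hup.submatrix (Subtype.val : {i // ¬ p i} → ι)
      convert this using 1
      ext i j
      simp [D, Matrix.toBlock, Matrix.one_apply, Subtype.ext_iff]
    have h2 : (Bᴴ * W⁻¹ * B).PosSemidef := hW.inv.posSemidef.conjTranspose_mul_mul_same B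
    convert h1.add h2 using 1
    abel
  refine ⟨hWpos, ?_, ?_⟩
  · rw [hdet, mul_comm]
    exact mul_le_mul_of_nonneg_left (pow_le_det hc.le hlow') hWpos.le
  · rw [hdet, mul_comm]
    exact mul_le_mul_of_nonneg_right (det_le_pow hS hup') hWpos.le

theorem posSemidef_vecMulVec_self_real {ι : Type*} [Fintype ι] (v : ι → ℝ) :
    (Matrix.vecMulVec v v).PosSemidef := by
  simpa using Matrix.posSemidef_vecMulVec_self_star v

/-- By the matrix determinant lemma the factor is `1 + vᵀ A⁻¹ v`, and `A⁻¹` is at most `1 / c`. -/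
theorem det_add_vecMulVec_bounds {A : Matrix ι ι ℝ} {a c : ℝ} (hc : 0 < c)
    (hlow : (A - c • (1 : Matrix ι ι ℝ)).PosSemidef) (v : ι → ℝ) (hv : v ⬝ᵥ v ≤ a) :
    A.det ≤ (A + Matrix.vecMulVec v v).det ∧
    (A + Matrix.vecMulVec v v).det ≤ A.det * (1 + a / c) := by
  have hA := posDef_of_sub_smul_one hc hlow
  have hpos := hA.det_pos
  have hu : IsUnit A.det := isUnit_iff_ne_zero.2 hpos.ne'
  have hdet : (A + Matrix.vecMulVec v v).det = A.det * (1 + v ⬝ᵥ (A⁻¹ *ᵥ v)) := by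
    have := Matrix.det_add_replicateCol_mul_replicateRow (ι := Unit) hu v v
    rw [← Matrix.vecMulVec_eq] at this
    rw [this]
    congr 1
    simp [Matrix.det_unique, Matrix.mul_apply, dotProduct, mulVec, Finset.sum_mul, Finset.mul_sum,
      mul_assoc]
    exact Finset.sum_comm
  set y := A⁻¹ *ᵥ v with hy
  have hAy : A *ᵥ y = v := by
    rw [hy, Matrix.mulVec_mulVec, Matrix.mul_nonsing_inv _ hu, Matrix.one_mulVec]
  have h1 := mul_dotProduct_le hlow y
  rw [hAy] at h1
  have hyy : 0 ≤ y ⬝ᵥ y := by simpa using dotProduct_star_self_nonneg y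
  have h0 : 0 ≤ y ⬝ᵥ v := le_trans (mul_nonneg hc.le hyy) h1
  have hcs : (y ⬝ᵥ v) ^ 2 ≤ (y ⬝ᵥ y) * (v ⬝ᵥ v) := by
    simpa [dotProduct, sq] using Finset.sum_mul_sq_le_sq_mul_sq Finset.univ y v
  have h2 : y ⬝ᵥ v ≤ a / c := by
    rw [le_div_iff₀ hc]
    have hvv : 0 ≤ v ⬝ᵥ v := by simpa using dotProduct_star_self_nonneg v
    -- With `y = A⁻¹ v`, combine `c |y|² ≤ y ⬝ v` with Cauchy–Schwarz `(y ⬝ v)² ≤ |y|² |v|²`, then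
    -- cancel one factor `y ⬝ v` if it is positive.
    rcases h0.eq_or_lt with h | h
    · rw [← h]; linarith
    · refine le_of_mul_le_mul_left ?_ h
      nlinarith
  rw [hdet, dotProduct_comm v y]
  constructor
  · nlinarith
  · exact mul_le_mul_of_nonneg_left (by linarith) hpos.le

/-- Rank-one terms are non-negative, so the lower bound `c` survives each addition and every step
costs the same factor. -/
theorem det_add_sum_vecMulVec_bounds {A : Matrix ι ι ℝ} {a c : ℝ} (hc : 0 < c) (ha : 0 ≤ a)
    (hlow : (A - c • (1 : Matrix ι ι ℝ)).PosSemidef) (s : Finset κ) (v : κ → ι → ℝ)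
    (hv : ∀ p ∈ s, v p ⬝ᵥ v p ≤ a) :
    ((A + ∑ p ∈ s, Matrix.vecMulVec (v p) (v p)) - c • (1 : Matrix ι ι ℝ)).PosSemidef ∧
    A.det ≤ (A + ∑ p ∈ s, Matrix.vecMulVec (v p) (v p)).det ∧
    (A + ∑ p ∈ s, Matrix.vecMulVec (v p) (v p)).det ≤ A.det * (1 + a / c) ^ s.card := by
  classical
  induction s using Finset.induction_on with
  | empty => simpa using hlow
  | insert q s hq ih =>
    obtain ⟨h1, h2, h3⟩ := ih fun p hp => hv p (Finset.mem_insert_of_mem hp)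
    have hb := det_add_vecMulVec_bounds hc h1 (v q) (hv q (Finset.mem_insert_self _ _))
    rw [Finset.sum_insert hq, Finset.card_insert_of_notMem hq, pow_succ,
      add_comm (Matrix.vecMulVec (v q) (v q)), ← add_assoc]
    refine ⟨?_, h2.trans hb.1, hb.2.trans ?_⟩
    · convert h1.add (posSemidef_vecMulVec_self_real (v q)) using 1
      abel
    · rw [← mul_assoc]
      exact mul_le_mul_of_nonneg_right h3 (by positivity)

end LinearAlgebra

end LatticeMaxwell
namespace LatticeMaxwell

open Matrix

/-! ### Dirichlet and Neumann modes and their orthogonality. -/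

section Modes

/-- The Dirichlet mode `sin(π k x / n)`. -/
noncomputable def sinMode (n : ℕ) (k x : ℤ) : ℝ := Real.sin (Real.pi * k * x / n)

/-- The Neumann mode `cos(π k (x + 1/2) / n)`. -/
noncomputable def cosMode (n : ℕ) (k x : ℤ) : ℝ := Real.cos (Real.pi * k * (x + 1 / 2) / n)

/-- The symbol `2 sin(π k / (2n))` of the lattice derivative. -/
noncomputable def freq (n : ℕ) (k : ℤ) : ℝ := 2 * Real.sin (Real.pi * k / (2 * n))

variable {n : ℕ} (k l x : ℤ)

/-- The half-step in `cosMode` makes this first-order relation exact. Together with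
`cosMode_sub_one_sub` it says that the forward derivative turns Dirichlet modes into Neumann modes
and the backward derivative turns them back, with the same factor; the second-order identities
follow. -/
theorem sinMode_add_one_sub : sinMode n k (x + 1) - sinMode n k x = freq n k * cosMode n k x := by
  rw [sinMode, sinMode, freq, cosMode, Real.sin_sub_sin]
  push_cast
  congr 1
  · congr 2; ring
  · congr 1; ring

theorem sinMode_sub_one_sub :
    sinMode n k (x - 1) - sinMode n k x = -(freq n k * cosMode n k (x - 1)) := by
  have := sinMode_add_one_sub (n := n) k (x - 1)
  rw [sub_add_cancel] at this
  linarith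

theorem cosMode_sub_one_sub : cosMode n k (x - 1) - cosMode n k x = freq n k * sinMode n k x := by
  rw [cosMode, cosMode, freq, sinMode, Real.cos_sub_cos]
  push_cast
  have h1 : (Real.pi * k * (x - 1 + 1 / 2) / n + Real.pi * k * (x + 1 / 2) / n) / 2 =
      Real.pi * k * x / n := by ring
  have h2 : (Real.pi * k * (x - 1 + 1 / 2) / n - Real.pi * k * (x + 1 / 2) / n) / 2 =
      -(Real.pi * k / (2 * n)) := by ring
  rw [h1, h2, Real.sin_neg]
  ring

theorem sinMode_laplacian :
    2 * sinMode n k x - sinMode n k (x + 1) - sinMode n k (x - 1) =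
      freq n k ^ 2 * sinMode n k x := by
  have h1 := sinMode_add_one_sub (n := n) k x
  have h2 := sinMode_sub_one_sub (n := n) k x
  have h3 := cosMode_sub_one_sub (n := n) k x
  linear_combination -h1 - h2 + freq n k * h3

theorem cosMode_laplacian :
    2 * cosMode n k x - cosMode n k (x + 1) - cosMode n k (x - 1) =
      freq n k ^ 2 * cosMode n k x := by
  have h1 := sinMode_add_one_sub (n := n) k x
  have h2 := cosMode_sub_one_sub (n := n) k (x + 1)
  rw [add_sub_cancel_right] at h2
  have h3 := cosMode_sub_one_sub (n := n) k x
  linear_combination freq n k * h1 + h2 - h3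

theorem sinMode_zero : sinMode n k 0 = 0 := by simp [sinMode]

theorem sinMode_self : sinMode n k n = 0 := by
  rcases Nat.eq_zero_or_pos n with h | h
  · subst h; simp [sinMode]
  · have : Real.pi * k * ((n : ℤ) : ℝ) / n = k * Real.pi := by
      have : (n : ℝ) ≠ 0 := by positivity
      push_cast
      field_simp
    rw [sinMode, this, Real.sin_int_mul_pi]

theorem cosMode_neg_one : cosMode n k (-1) = cosMode n k 0 := by
  have := cosMode_sub_one_sub (n := n) k 0
  rw [sinMode_zero, mul_zero, zero_sub] at this
  linarith

theorem cosMode_self : cosMode n k n = cosMode n k (n - 1) := by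
  have := cosMode_sub_one_sub (n := n) k n
  rw [sinMode_self, mul_zero] at this
  linarith

theorem freq_sq : freq n k ^ 2 = 2 * (1 - Real.cos (Real.pi * (k / n))) := by
  have h := Real.cos_sq' (Real.pi * k / (2 * n))
  have h2 := Real.cos_two_mul (Real.pi * k / (2 * n))
  rw [show 2 * (Real.pi * k / (2 * n)) = Real.pi * ((k : ℝ) / n) by ring] at h2
  rw [h2, freq, mul_pow, h]
  ring

theorem freq_zero : freq n 0 = 0 := by simp [freq]

variable {k l}

theorem freq_sq_injOn (hk : 0 ≤ k) (hkn : k < n) (hl : 0 ≤ l) (hln : l < n)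
    (h : freq n k ^ 2 = freq n l ^ 2) : k = l := by
  have hn : (0 : ℝ) < n := by
    have : 0 < (n : ℤ) := by omega
    exact_mod_cast this
  have key : ∀ m : ℤ, 0 ≤ m → m < n → Real.pi * ((m : ℝ) / n) ∈ Set.Icc 0 Real.pi := by
    intro m h0 h1
    have h0' : (0 : ℝ) ≤ m := by exact_mod_cast h0
    have h1' : (m : ℝ) ≤ n := by exact_mod_cast h1.le
    have : (m : ℝ) / n ≤ 1 := (div_le_one hn).2 h1'
    have h2 : 0 ≤ (m : ℝ) / n := by positivity
    constructor
    · positivity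
    · nlinarith [Real.pi_pos]
  rw [freq_sq, freq_sq] at h
  have := Real.injOn_cos (key k hk hkn) (key l hl hln) (by linarith)
  have := mul_left_cancel₀ Real.pi_pos.ne' this
  rw [div_left_inj' hn.ne'] at this
  exact_mod_cast this

theorem Ico_int_add_one {a b : ℤ} (h : a ≤ b) :
    Finset.Ico a (b + 1) = insert b (Finset.Ico a b) := by
  ext x
  simp only [Finset.mem_Ico, Finset.mem_insert]
  omega

theorem sum_Ico_sub_prev (W : ℤ → ℝ) {a b : ℤ} (h : a ≤ b) :
    ∑ x ∈ Finset.Ico a b, (W x - W (x - 1)) = W (b - 1) - W (a - 1) := by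
  induction b, h using Int.leInduction with
  | base => simp
  | succ b hb ih =>
    rw [Ico_int_add_one hb, Finset.sum_insert (by simp), ih, add_sub_cancel_right]
    ring

/-- Discrete Green identity: `(lam - μ) f g` is a difference of consecutive Wronskians, so the sum
telescopes, and the boundary hypotheses make both end Wronskians vanish. Orthogonality of the modes
follows without evaluating trigonometric sums. -/
theorem sum_mul_eq_zero_of_wronskian {f g : ℤ → ℝ} {lam μ : ℝ} (hne : lam ≠ μ)
    (hf : ∀ x, 2 * f x - f (x + 1) - f (x - 1) = lam * f x)
    (hg : ∀ x, 2 * g x - g (x + 1) - g (x - 1) = μ * g x) {a b : ℤ} (hab : a ≤ b)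
    (hb : f (b - 1) * g b = g (b - 1) * f b) (ha : f (a - 1) * g a = g (a - 1) * f a) :
    ∑ x ∈ Finset.Ico a b, f x * g x = 0 := by
  have h := sum_Ico_sub_prev (fun x => f x * g (x + 1) - g x * f (x + 1)) hab
  simp only [sub_add_cancel] at h
  rw [hb, ha, sub_self, sub_self, sub_self] at h
  have h2 : (lam - μ) * ∑ x ∈ Finset.Ico a b, f x * g x = 0 := by
    rw [← h, Finset.mul_sum]
    refine Finset.sum_congr rfl fun x _ => ?_
    linear_combination -(g x) * hf x + f x * hg x
  exact (mul_eq_zero.1 h2).resolve_left (sub_ne_zero.2 hne)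

theorem sinMode_one_pos (hk : 1 ≤ k) (hkn : k < n) : 0 < sinMode n k 1 := by
  have hn : (0 : ℝ) < n := by
    have : 0 < (n : ℤ) := by omega
    exact_mod_cast this
  have h0' : (0 : ℝ) < k := by exact_mod_cast (show 0 < k by omega)
  have h1' : (k : ℝ) < n := by exact_mod_cast hkn
  refine Real.sin_pos_of_pos_of_lt_pi ?_ ?_
  · have := Real.pi_pos
    push_cast
    positivity
  · push_cast
    rw [mul_one, div_lt_iff₀ hn]
    exact mul_lt_mul_of_pos_left h1' Real.pi_pos

theorem cosMode_zero_pos (hk : 0 ≤ k) (hkn : k < n) : 0 < cosMode n k 0 := by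
  have hn : (0 : ℝ) < n := by
    have : 0 < (n : ℤ) := by omega
    exact_mod_cast this
  have h0' : (0 : ℝ) ≤ k := by exact_mod_cast hk
  have h1' : (k : ℝ) < n := by exact_mod_cast hkn
  have h := Real.pi_pos
  refine Real.cos_pos_of_mem_Ioo ⟨?_, ?_⟩
  · have : 0 ≤ Real.pi * k * (((0 : ℤ) : ℝ) + 1 / 2) / n := by push_cast; positivity
    linarith
  · push_cast
    rw [div_lt_iff₀ hn]
    nlinarith

variable {d : ℕ}

/-- The one-dimensional factor in direction `l` of the modes of the `j`-th field component:
Neumann for `l = j` and Dirichlet otherwise. -/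
noncomputable def dirMode (n : ℕ) (j l : Fin d) (k x : ℤ) : ℝ :=
  if l = j then cosMode n k x else sinMode n k x

/-- The range of positions and of frequencies of `dirMode`. -/
noncomputable def dirRange (n : ℕ) (j l : Fin d) : Finset ℤ :=
  if l = j then Finset.Ico 0 (n : ℤ) else Finset.Ico 1 (n : ℤ)

theorem mem_dirRange {j l : Fin d} {x : ℤ} :
    x ∈ dirRange n j l ↔ 0 ≤ x ∧ x < n ∧ (l ≠ j → 1 ≤ x) := by
  unfold dirRange
  split_ifs with h <;> simp [h] <;> omega

theorem sum_dirMode_mul_eq_zero {j l : Fin d} {k k' : ℤ} (hk : k ∈ dirRange n j l)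
    (hk' : k' ∈ dirRange n j l) (hne : k ≠ k') :
    ∑ x ∈ dirRange n j l, dirMode n j l k x * dirMode n j l k' x = 0 := by
  rw [mem_dirRange] at hk hk'
  have hfreq : freq n k ^ 2 ≠ freq n k' ^ 2 := fun h =>
    hne (freq_sq_injOn hk.1 hk.2.1 hk'.1 hk'.2.1 h)
  unfold dirRange dirMode
  split_ifs with h
  · refine sum_mul_eq_zero_of_wronskian hfreq (cosMode_laplacian k) (cosMode_laplacian k')
      (by omega) ?_ ?_
    · rw [cosMode_self, cosMode_self, mul_comm]
    · rw [zero_sub, cosMode_neg_one, cosMode_neg_one, mul_comm]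
  · refine sum_mul_eq_zero_of_wronskian hfreq (sinMode_laplacian k) (sinMode_laplacian k')
      (by omega) ?_ ?_
    · rw [sinMode_self, sinMode_self, mul_zero, mul_zero]
    · rw [sub_self, sinMode_zero, sinMode_zero, zero_mul, zero_mul]

theorem sum_dirMode_mul_self_pos {j l : Fin d} {k : ℤ} (hk : k ∈ dirRange n j l) :
    0 < ∑ x ∈ dirRange n j l, dirMode n j l k x * dirMode n j l k x := by
  have hk' := mem_dirRange.1 hk
  refine Finset.sum_pos' (fun x _ => mul_self_nonneg _) ?_
  by_cases h : l = j
  · refine ⟨0, mem_dirRange.2 (by simp [h]; omega), ?_⟩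
    have := cosMode_zero_pos hk'.1 hk'.2.1
    rw [dirMode, if_pos h]
    positivity
  · have h1 := hk'.2.2 h
    refine ⟨1, mem_dirRange.2 ⟨by omega, by omega, fun _ => le_rfl⟩, ?_⟩
    have := sinMode_one_pos h1 hk'.2.1
    rw [dirMode, if_neg h]
    positivity

/-- The modes of the `j`-th field component. -/
noncomputable def fieldMode (n : ℕ) (j : Fin d) (k x : Site d) : ℝ :=
  ∏ l, dirMode n j l (k l) (x l)

/-- The sites, and frequencies, of the `j`-th field component. -/
noncomputable def modeBox (n : ℕ) (j : Fin d) : Finset (Site d) :=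
  Fintype.piFinset fun l => dirRange n j l

theorem mem_modeBox {j : Fin d} {x : Site d} :
    x ∈ modeBox n j ↔ ∀ l, 0 ≤ x l ∧ x l < n ∧ (l ≠ j → 1 ≤ x l) := by
  simp [modeBox, mem_dirRange]

theorem sum_fieldMode_mul (j : Fin d) (k k' : Site d) :
    ∑ x ∈ modeBox n j, fieldMode n j k x * fieldMode n j k' x =
      ∏ l, ∑ y ∈ dirRange n j l, dirMode n j l (k l) y * dirMode n j l (k' l) y := by
  rw [Finset.prod_univ_sum]
  refine Finset.sum_congr rfl fun x _ => ?_
  rw [fieldMode, fieldMode, Finset.prod_mul_distrib]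

/-- The edges on which the comparison operator lives: all directions but `o`, with
Dirichlet conditions. -/
noncomputable def refEdges (n : ℕ) (o : Fin d) : Finset (Site d × Fin d) :=
  (Finset.univ.erase o).biUnion fun i => modeBox n i ×ˢ {i}

theorem mem_refEdges {o : Fin d} {e : Site d × Fin d} :
    e ∈ refEdges n o ↔ e.2 ≠ o ∧ e.1 ∈ modeBox n e.2 := by
  obtain ⟨x, i⟩ := e
  simp only [refEdges, Finset.mem_biUnion, Finset.mem_erase, Finset.mem_product,
    Finset.mem_singleton]
  constructor
  · rintro ⟨a, ha, hx, rfl⟩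
    exact ⟨ha.1, hx⟩
  · rintro ⟨h1, h2⟩
    exact ⟨i, ⟨h1, Finset.mem_univ _⟩, h2, rfl⟩

theorem sum_refEdges {o : Fin d} (f : Site d × Fin d → ℝ) :
    ∑ e ∈ refEdges n o, f e =
      ∑ i ∈ Finset.univ.erase o, ∑ x ∈ modeBox n i, f (x, i) := by
  rw [refEdges, Finset.sum_biUnion]
  · refine Finset.sum_congr rfl fun i _ => ?_
    rw [Finset.sum_product]
    simp
  · intro i _ j _ hij
    rw [Function.onFun, Finset.disjoint_left]
    rintro ⟨x, a⟩ h1 h2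
    simp only [Finset.mem_product, Finset.mem_singleton] at h1 h2
    exact hij (h1.2.symm.trans h2.2)

/-- The matrix whose columns are the modes. -/
noncomputable def modeMatrix (n : ℕ) (o : Fin d) : Matrix (refEdges n o) (refEdges n o) ℝ :=
  Matrix.of fun e q => if e.1.2 = q.1.2 then fieldMode n e.1.2 q.1.1 e.1.1 else 0

/-- The columns are orthogonal and non-zero, so their Gram matrix is diagonal with positive entries.
Normalisation is irrelevant because this determinant cancels in `det_gram_refEdges`. -/
theorem det_modeMatrix_ne_zero (o : Fin d) : (modeMatrix n o).det ≠ 0 := by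
  have key : (modeMatrix n o)ᵀ * modeMatrix n o = Matrix.diagonal fun q =>
      ∏ l, ∑ y ∈ dirRange n q.1.2 l,
        dirMode n q.1.2 l (q.1.1 l) y * dirMode n q.1.2 l (q.1.1 l) y := by
    ext ⟨⟨k, j⟩, hk⟩ ⟨⟨k', j'⟩, hk'⟩
    have hk1 := mem_refEdges.1 hk
    have hk1' := mem_refEdges.1 hk'
    simp only at hk1 hk1'
    have hsum : ((modeMatrix n o)ᵀ * modeMatrix n o) ⟨(k, j), hk⟩ ⟨(k', j'), hk'⟩ =
        if j = j' then ∑ x ∈ modeBox n j, fieldMode n j k x * fieldMode n j k' x else 0 := by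
      rw [Matrix.mul_apply]
      simp only [modeMatrix, Matrix.transpose_apply, Matrix.of_apply]
      rw [Finset.sum_coe_sort (refEdges n o) (fun e : Site d × Fin d =>
        (if e.2 = j then fieldMode n e.2 k e.1 else 0) *
          (if e.2 = j' then fieldMode n e.2 k' e.1 else 0)), sum_refEdges,
        Finset.sum_eq_single j]
      · by_cases h : j = j' <;> simp [h]
      · intro i _ hi
        simp [hi]
      · intro h
        exact absurd (Finset.mem_erase.2 ⟨hk1.1, Finset.mem_univ _⟩) h
    rw [hsum, Matrix.diagonal_apply]
    by_cases hj : j = j'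
    · subst hj
      rw [if_pos rfl, sum_fieldMode_mul]
      by_cases hkk : k = k'
      · subst hkk; simp
      · rw [if_neg (by simpa using hkk)]
        obtain ⟨l, hl⟩ := Function.ne_iff.1 hkk
        exact Finset.prod_eq_zero (Finset.mem_univ l) (sum_dirMode_mul_eq_zero
          (Fintype.mem_piFinset.1 hk1.2 l) (Fintype.mem_piFinset.1 hk1'.2 l) hl)
    · rw [if_neg hj, if_neg (by simp [hj])]
  have hdet := congrArg Matrix.det key
  rw [Matrix.det_mul, Matrix.det_transpose, Matrix.det_diagonal] at hdet
  intro h0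
  rw [h0, zero_mul] at hdet
  refine (Finset.prod_pos fun q _ => Finset.prod_pos fun l _ => ?_).ne hdet
  exact sum_dirMode_mul_self_pos (Fintype.mem_piFinset.1 (mem_refEdges.1 q.2).2 l)

end Modes

end LatticeMaxwell
namespace LatticeMaxwell

open Matrix

variable {d : ℕ}

/-! ### Lattice derivatives and `Q` as the form of the curl. -/

section Operators

theorem partialD_apply (i : Fin d) (φ : L2 d) (x : Site d) :
    partialD i φ x = φ (x + unit i) - φ x := rfl

theorem partialStar_apply (i : Fin d) (φ : L2 d) (x : Site d) :
    partialStar i φ x = φ (x - unit i) - φ x := by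
  rw [sub_eq_add_neg x]
  rfl

theorem inner_shift_left (v : Site d) (φ ψ : L2 d) :
    inner ℝ (shift v φ) ψ = inner ℝ φ (shift (-v) ψ) := by
  have : ψ = shift v (shift (-v) ψ) := by
    ext x
    change ψ x = ψ (x + v + -v)
    rw [add_neg_cancel_right]
  conv_lhs => rw [this]
  exact (shift v).inner_map_map _ _

theorem inner_partialD_left (i : Fin d) (φ ψ : L2 d) :
    inner ℝ (partialD i φ) ψ = inner ℝ φ (partialStar i ψ) := by
  change inner ℝ (shift (unit i) φ - φ) ψ = inner ℝ φ (shift (-unit i) ψ - ψ)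
  rw [inner_sub_left, inner_sub_right, inner_shift_left]

theorem partialD_partialStar_comm (i j : Fin d) (φ : L2 d) :
    partialD i (partialStar j φ) = partialStar j (partialD i φ) := by
  ext x
  simp only [partialD_apply, partialStar_apply]
  rw [show x + unit i - unit j = x - unit j + unit i by abel]
  ring

theorem Q_apply (w : Fields d) (i : Fin d) :
    Q d w i = ∑ j, partialStar j (partialD j (w i)) - ∑ j, partialD i (partialStar j (w j)) := by
  simp [Q, negLaplacian]

/-- The component `∂_i w_j - ∂_j w_i` of the curl. -/
noncomputable def curl (i j : Fin d) (w : Fields d) : L2 d :=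
  partialD i (w j) - partialD j (w i)

theorem curl_apply (i j : Fin d) (w : Fields d) (x : Site d) :
    curl i j w x = plaquetteValue (fun e => w e.2 e.1) (x, i, j) := by
  change (w j (x + unit i) - w j x) - (w i (x + unit j) - w i x) = _
  simp only [plaquetteValue]
  ring

/-- Summation by parts and the commutation of `∂_i` with `∂_j^*` turn the left side into a double
sum over `i, j`. The product of curls is its symmetrisation in `i` and `j`, hence the factor `1 /
2`. -/
theorem inner_Q (v w : Fields d) :
    inner ℝ v (Q d w) = (1 / 2 : ℝ) * ∑ i, ∑ j, inner ℝ (curl i j v) (curl i j w) := by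
  have h1 : inner ℝ v (Q d w) =
      ∑ j, ∑ i, (inner ℝ (partialD i (v j)) (partialD i (w j)) -
        inner ℝ (partialD i (v j)) (partialD j (w i)) : ℝ) := by
    rw [PiLp.inner_apply]
    refine Finset.sum_congr rfl fun j _ => ?_
    rw [Q_apply, inner_sub_right, inner_sum, inner_sum, ← Finset.sum_sub_distrib]
    refine Finset.sum_congr rfl fun i _ => ?_
    rw [inner_partialD_left, inner_partialD_left, partialD_partialStar_comm]
  have h2 : ∑ i, ∑ j, (inner ℝ (curl i j v) (curl i j w) : ℝ) =
      ∑ i, ∑ j, ((inner ℝ (partialD i (v j)) (partialD i (w j)) -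
        inner ℝ (partialD i (v j)) (partialD j (w i))) +
        (inner ℝ (partialD j (v i)) (partialD j (w i)) -
        inner ℝ (partialD j (v i)) (partialD i (w j))) : ℝ) := by
    refine Finset.sum_congr rfl fun i _ => Finset.sum_congr rfl fun j _ => ?_
    rw [curl, curl, inner_sub_left, inner_sub_right, inner_sub_right]
    ring
  rw [h2]
  simp only [Finset.sum_add_distrib]
  rw [h1]
  nth_rewrite 2 [Finset.sum_comm]
  ring

theorem Q_symmetric (v w : Fields d) : inner ℝ v (Q d w) = inner ℝ (Q d v) w := by
  rw [real_inner_comm w (Q d v), inner_Q, inner_Q]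
  simp only [real_inner_comm]

theorem inner_self_Q (w : Fields d) :
    inner ℝ w (Q d w) = (1 / 2 : ℝ) * ∑ i, ∑ j, ‖partialD i (w j) - partialD j (w i)‖ ^ 2 := by
  rw [inner_Q]
  simp only [real_inner_self_eq_norm_sq, curl]

end Operators

/-! ### Plaquettes meeting the box, and a Poincaré inequality in the axial gauge. -/

section Box

theorem mem_box {n : ℕ} {x : Site d} : x ∈ box d n ↔ ∀ i, 0 ≤ x i ∧ x i ≤ n := by
  simp [box]

theorem mem_edges {n : ℕ} {x : Site d} {i : Fin d} :
    (x, i) ∈ edges d n ↔ x ∈ box d n ∧ x + unit i ∈ box d n := by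
  simp [edges]

theorem mem_treeEdges {n : ℕ} {x : Site d} {i : Fin d} :
    (x, i) ∈ treeEdges d n ↔ (x, i) ∈ edges d n ∧ ∀ k, i < k → x k = 0 := by
  simp [treeEdges]

theorem mem_plaquettes {n : ℕ} {x : Site d} {j k : Fin d} :
    (x, j, k) ∈ plaquettes d n ↔ x ∈ box d n ∧ j < k ∧ x + unit j ∈ box d n ∧
      x + unit j + unit k ∈ box d n ∧ x + unit k ∈ box d n := by
  simp [plaquettes]

theorem unit_apply (i k : Fin d) : unit i k = if k = i then 1 else 0 := by
  simp [unit, Pi.single_apply]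

/-- All plaquettes of `ℤ^d` that meet `Λ_n`. -/
noncomputable def outerPlaquettes (d n : ℕ) : Finset (Site d × Fin d × Fin d) :=
  ((Fintype.piFinset fun _ => Finset.Icc (-1) (n : ℤ)) ×ˢ Finset.univ).filter
    fun p => p.2.1 < p.2.2

theorem plaquettes_subset_outerPlaquettes (d n : ℕ) :
    plaquettes d n ⊆ outerPlaquettes d n := by
  rintro ⟨x, j, k⟩ h
  rw [mem_plaquettes, mem_box] at h
  simp only [outerPlaquettes, Finset.mem_filter, Finset.mem_product, Fintype.mem_piFinset,
    Finset.mem_Icc, Finset.mem_univ, and_true]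
  exact ⟨fun i => ⟨by linarith [(h.1 i).1], (h.1 i).2⟩, h.2.1⟩

theorem half_sum_sum_eq_sum_lt (G : Fin d → Fin d → ℝ) (hG : ∀ i j, G i j = G j i)
    (hG0 : ∀ i, G i i = 0) :
    (1 / 2 : ℝ) * ∑ i, ∑ j, G i j = ∑ i, ∑ j, if i < j then G i j else 0 := by
  have h : ∀ i j, G i j = (if i < j then G i j else 0) + (if j < i then G j i else 0) := by
    intro i j
    rcases lt_trichotomy i j with h | h | h
    · simp [h, h.le]
    · subst h; simp [hG0]
    · simp [h, h.le, hG i j]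
  have h2 : ∑ i, ∑ j, G i j = ∑ i, ∑ j, (if i < j then G i j else 0) +
      ∑ i, ∑ j, (if j < i then G j i else 0) := by
    simp only [← Finset.sum_add_distrib]
    exact Finset.sum_congr rfl fun i _ => Finset.sum_congr rfl fun j _ => h i j
  rw [h2]
  nth_rewrite 2 [Finset.sum_comm]
  ring

theorem inner_Q_eq_sum_outerPlaquettes {n : ℕ} (v w : Fields d)
    (hv : ∀ i, ∀ x ∉ box d n, v i x = 0) :
    inner ℝ v (Q d w) = ∑ p ∈ outerPlaquettes d n,
      plaquetteValue (fun e => v e.2 e.1) p * plaquetteValue (fun e => w e.2 e.1) p := by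
  set B : Finset (Site d) := Fintype.piFinset fun _ => Finset.Icc (-1) (n : ℤ) with hB
  have hinner : ∀ i j, (inner ℝ (curl i j v) (curl i j w) : ℝ) = ∑ x ∈ B,
      plaquetteValue (fun e => v e.2 e.1) (x, i, j) *
        plaquetteValue (fun e => w e.2 e.1) (x, i, j) := by
    intro i j
    rw [lp.inner_eq_tsum, tsum_eq_sum (s := B)]
    · refine Finset.sum_congr rfl fun x _ => ?_
      rw [curl_apply, curl_apply]
      simp [mul_comm]
    · intro x hx
      -- The corners of a plaquette based at `x` exceed `x` by `0` or `1` in each coordinate. One of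
      -- them can lie in the box only if all coordinates of `x` are in `[-1, n]`.
      have hout : ∀ y : Site d, (∀ l, y l = x l ∨ y l = x l + 1) → y ∉ box d n := by
        intro y hy hmem
        refine hx (Fintype.mem_piFinset.2 fun l => Finset.mem_Icc.2 ?_)
        have := mem_box.1 hmem l
        rcases hy l with h | h <;> omega
      have hone : ∀ k : Fin d, x + unit k ∉ box d n := fun k => hout _ fun l => by
        rw [Pi.add_apply, unit_apply]
        split_ifs <;> simp
      have h0 : x ∉ box d n := hout _ fun l => Or.inl rfl
      have : curl i j v x = 0 := by
        rw [curl_apply]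
        simp only [plaquetteValue, hv _ _ h0, hv _ _ (hone i), hv _ _ (hone j)]
        norm_num
      rw [this]
      simp
  rw [inner_Q]
  simp only [hinner]
  rw [half_sum_sum_eq_sum_lt]
  · symm
    rw [outerPlaquettes, Finset.sum_filter, Finset.sum_product, Finset.sum_comm,
      Fintype.sum_prod_type]
    refine Finset.sum_congr rfl fun i _ => Finset.sum_congr rfl fun j _ => ?_
    split_ifs
    · rfl
    · exact Finset.sum_const_zero
  · intro i j
    refine Finset.sum_congr rfl fun x _ => ?_
    simp only [plaquetteValue]
    ring
  · intro i
    refine Finset.sum_eq_zero fun x _ => ?_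
    simp only [plaquetteValue]
    ring

/-- Induction on the number of unit steps from `x` down to the tree. One step uses a plaquette whose
two transverse edges lie in the tree, so the values on the two parallel edges differ by exactly one
plaquette value. -/
theorem abs_le_of_axial {n : ℕ} {u : Site d × Fin d → ℝ} {r : ℝ}
    (hu : ∀ e ∈ treeEdges d n, u e = 0)
    (hr : ∀ p ∈ plaquettes d n, |plaquetteValue u p| ≤ r) (m : ℕ) :
    ∀ x i, (x, i) ∈ edges d n → (∑ k, if i < k then x k else 0) = m → |u (x, i)| ≤ m * r := by
  induction m with
  | zero =>
    intro x i he hs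
    have hx := fun k => mem_box.1 (mem_edges.1 he).1 k
    rw [hu _ (mem_treeEdges.2 ⟨he, fun k hk => ?_⟩)]
    · simp
    · have := (Finset.sum_eq_zero_iff_of_nonneg (fun k _ => by
        split_ifs
        · exact (hx k).1
        · exact le_rfl)).1 hs k (Finset.mem_univ _)
      simpa [hk] using this
  | succ m ih =>
    intro x i he hs
    obtain ⟨hx, hxi⟩ := mem_edges.1 he
    rw [mem_box] at hx hxi
    have hne : (Finset.univ.filter fun k => i < k ∧ x k ≠ 0).Nonempty := by
      by_contra hcon
      rw [Finset.not_nonempty_iff_eq_empty, Finset.filter_eq_empty_iff] at hcon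
      have : (∑ k, if i < k then x k else 0) = 0 := Finset.sum_eq_zero fun k _ => by
        have := hcon (Finset.mem_univ k)
        split_ifs with h
        · by_contra hk; exact this ⟨h, hk⟩
        · rfl
      rw [this] at hs
      push_cast at hs
      omega
    -- Choosing the last non-zero coordinate `k > i` puts both `k`-edges of the plaquette based at
    -- `x - e_k` into the tree.
    obtain ⟨k, hk, hmax⟩ := Finset.exists_max_image _ id hne
    simp only [Finset.mem_filter, Finset.mem_univ, true_and, id] at hk hmax
    have hzero : ∀ l, k < l → x l = 0 := by
      intro l hl
      by_contra h
      exact absurd (hmax l ⟨hk.1.trans hl, h⟩) (not_le.2 hl)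
    set y : Site d := x - unit k with hy
    have hyk : y + unit k = x := sub_add_cancel _ _
    have hyik : y + unit i + unit k = x + unit i := by rw [hy]; abel
    have hyl : ∀ l, y l = x l - if l = k then 1 else 0 := fun l => by
      rw [hy, Pi.sub_apply, unit_apply]
    have hxk : 1 ≤ x k := by
      have := (hx k).1
      have := hk.2
      omega
    have hybox : y ∈ box d n := mem_box.2 fun l => by
      rw [hyl]
      have := hx l
      split_ifs with h
      · subst h; omega
      · omega
    have hyi : y + unit i ∈ box d n := mem_box.2 fun l => by
      have := hxi l
      rw [Pi.add_apply, hyl]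
      rw [Pi.add_apply] at this
      split_ifs with h
      · subst h
        rw [unit_apply, if_neg hk.1.ne'] at this ⊢
        omega
      · omega
    have hxmem : x ∈ box d n := mem_box.2 hx
    have hximem : x + unit i ∈ box d n := mem_box.2 hxi
    have ht1 : u (y, k) = 0 := hu _ (mem_treeEdges.2
      ⟨mem_edges.2 ⟨hybox, hyk ▸ hxmem⟩, fun l hl => by
        rw [hyl, if_neg hl.ne', hzero l hl, sub_zero]⟩)
    have ht2 : u (y + unit i, k) = 0 := hu _ (mem_treeEdges.2
      ⟨mem_edges.2 ⟨hyi, hyik ▸ hximem⟩, fun l hl => by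
        rw [Pi.add_apply, hyl, if_neg hl.ne', hzero l hl, unit_apply,
          if_neg (hk.1.trans hl).ne']
        rfl⟩)
    have hp := hr (y, i, k) (mem_plaquettes.2
      ⟨hybox, hk.1, hyi, hyik ▸ hximem, hyk ▸ hxmem⟩)
    have hval : plaquetteValue u (y, i, k) = u (y, i) - u (x, i) := by
      simp only [plaquetteValue, ht1, ht2, hyk]
      ring
    have hrec := ih y i (mem_edges.2 ⟨hybox, hyi⟩) (by
      have : ∀ l, (if i < l then y l else 0) =
          (if i < l then x l else 0) - if l = k then 1 else 0 := by
        intro l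
        rw [hyl]
        by_cases h : l = k
        · subst h; simp [hk.1]
        · simp [h]
      simp only [this, Finset.sum_sub_distrib, hs]
      simp)
    rw [hval] at hp
    have := abs_sub_abs_le_abs_sub (u (x, i)) (u (y, i))
    rw [abs_sub_comm] at this
    push_cast
    linarith

theorem abs_le_of_mem_edges {n : ℕ} {u : Site d × Fin d → ℝ} {r : ℝ}
    (hu : ∀ e ∈ treeEdges d n, u e = 0)
    (hr : ∀ p ∈ plaquettes d n, |plaquetteValue u p| ≤ r) (hr0 : 0 ≤ r)
    {e : Site d × Fin d} (he : e ∈ edges d n) : |u e| ≤ (d * n : ℝ) * r := by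
  obtain ⟨x, i⟩ := e
  have hx := fun k => mem_box.1 (mem_edges.1 he).1 k
  have h0 : 0 ≤ ∑ k, if i < k then x k else 0 := Finset.sum_nonneg fun k _ => by
    split_ifs
    · exact (hx k).1
    · exact le_rfl
  have h1 : (∑ k, if i < k then x k else 0) ≤ d * n := by
    refine (Finset.sum_le_card_nsmul Finset.univ _ (n : ℤ) fun k _ => ?_).trans (by simp)
    split_ifs
    · exact (hx k).2
    · positivity
  obtain ⟨m, hm⟩ := Int.eq_ofNat_of_zero_le h0
  refine (abs_le_of_axial hu hr m x i he (by simpa using hm)).trans ?_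
  refine mul_le_mul_of_nonneg_right ?_ hr0
  rw [hm] at h1
  exact_mod_cast h1

end Box

end LatticeMaxwell
namespace LatticeMaxwell

open Matrix

variable {d : ℕ}

/-! ### Gram matrices of plaquette values and the spectral gap. -/

section Gram

/-- The field that is `1` on the edge `e` and `0` on all other edges. -/
noncomputable def edgeField (e : Site d × Fin d) : Fields d :=
  WithLp.toLp 2 (Pi.single e.2 (lp.single 2 e.1 (1 : ℝ)))

theorem edgeField_apply (e : Site d × Fin d) (i : Fin d) (x : Site d) :
    edgeField e i x = (Pi.single e 1 : Site d × Fin d → ℝ) (x, i) := by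
  obtain ⟨y, j⟩ := e
  simp only [edgeField, Pi.single_apply, Prod.mk.injEq]
  by_cases hj : i = j
  · subst hj
    simp [Pi.single_apply]
  · simp [hj]

theorem inner_edgeField (e : Site d × Fin d) (v : Fields d) :
    inner ℝ (edgeField e) v = v e.2 e.1 := by
  obtain ⟨y, j⟩ := e
  rw [PiLp.inner_apply, Finset.sum_eq_single j]
  · simp only [edgeField, Pi.single_eq_same]
    rw [lp.inner_single_left]
    simp
  · intro i _ hi
    simp [edgeField, hi]
  · simp

/-- The extension by zero of a function on a finite set of edges. -/
noncomputable def extendZero (S : Finset (Site d × Fin d)) (u : S → ℝ) : Site d × Fin d → ℝ :=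
  fun f => if h : f ∈ S then u ⟨f, h⟩ else 0

theorem extendZero_coe {S : Finset (Site d × Fin d)} (u : S → ℝ) (e : S) :
    extendZero S u e = u e := by
  simp [extendZero]

theorem extendZero_of_notMem {S : Finset (Site d × Fin d)} (u : S → ℝ) {f : Site d × Fin d}
    (h : f ∉ S) : extendZero S u f = 0 := by
  simp [extendZero, h]

theorem extendZero_eq_sum {S : Finset (Site d × Fin d)} (u : S → ℝ) (f : Site d × Fin d) :
    extendZero S u f = ∑ e : S, u e * (Pi.single e.1 1 : Site d × Fin d → ℝ) f := by
  by_cases h : f ∈ S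
  · rw [Finset.sum_eq_single ⟨f, h⟩]
    · simp [extendZero, h]
    · intro e _ he
      have : f ≠ e.1 := fun h' => he (Subtype.ext h'.symm)
      simp [this]
    · simp
  · rw [extendZero_of_notMem u h, Finset.sum_eq_zero]
    intro e _
    have : f ≠ e.1 := fun h' => h (h' ▸ e.2)
    simp [this]

theorem sum_smul_edgeField_apply {S : Finset (Site d × Fin d)} (u : S → ℝ) (i : Fin d)
    (x : Site d) : (∑ e : S, u e • edgeField e.1) i x = extendZero S u (x, i) := by
  rw [← inner_edgeField (x, i), inner_sum, extendZero_eq_sum]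
  refine Finset.sum_congr rfl fun e _ => ?_
  rw [inner_smul_right, inner_edgeField, edgeField_apply]

/-- The values on the plaquette `p` of the unit fields on the edges of `S`. -/
noncomputable def plaquetteVec (S : Finset (Site d × Fin d)) (p : Site d × Fin d × Fin d) :
    S → ℝ :=
  fun e => plaquetteValue (Pi.single e.1 1) p

/-- The matrix of the form `∑ p ∈ P, u_p v_p` on the functions on `S`. -/
noncomputable def gram (P : Finset (Site d × Fin d × Fin d)) (S : Finset (Site d × Fin d)) :
    Matrix S S ℝ :=
  ∑ p ∈ P, Matrix.vecMulVec (plaquetteVec S p) (plaquetteVec S p)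

theorem gram_apply (P : Finset (Site d × Fin d × Fin d)) (S : Finset (Site d × Fin d)) (e e' : S) :
    gram P S e e' = ∑ p ∈ P, plaquetteValue (Pi.single e.1 1) p *
      plaquetteValue (Pi.single e'.1 1) p := by
  simp [gram, Matrix.sum_apply, Matrix.vecMulVec_apply, plaquetteVec]

theorem sigmaZero_eq_gram (d n : ℕ) : sigmaZero d n = gram (plaquettes d n) (axialEdges d n) := by
  ext e e'
  rw [gram_apply]
  rfl

theorem plaquetteValue_extendZero {S : Finset (Site d × Fin d)} (u : S → ℝ)
    (p : Site d × Fin d × Fin d) :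
    plaquetteValue (extendZero S u) p = u ⬝ᵥ plaquetteVec S p := by
  simp only [plaquetteValue, extendZero_eq_sum, dotProduct, plaquetteVec, mul_sub, mul_add,
    Finset.sum_sub_distrib, Finset.sum_add_distrib]

theorem dotProduct_gram_mulVec (P : Finset (Site d × Fin d × Fin d))
    {S : Finset (Site d × Fin d)} (u : S → ℝ) :
    u ⬝ᵥ (gram P S *ᵥ u) = ∑ p ∈ P, plaquetteValue (extendZero S u) p ^ 2 := by
  rw [gram, Matrix.sum_mulVec, dotProduct_sum]
  refine Finset.sum_congr rfl fun p _ => ?_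
  rw [plaquetteValue_extendZero, Matrix.vecMulVec_mulVec, dotProduct_comm (plaquetteVec S p) u]
  simp [sq]

theorem gram_isHermitian (P : Finset (Site d × Fin d × Fin d)) (S : Finset (Site d × Fin d)) :
    (gram P S).IsHermitian := by
  ext e e'
  rw [Matrix.conjTranspose_apply, gram_apply, gram_apply, star_trivial]
  exact Finset.sum_congr rfl fun p _ => mul_comm _ _

theorem isHermitian_smul_one {ι : Type*} [DecidableEq ι] (c : ℝ) :
    (c • (1 : Matrix ι ι ℝ)).IsHermitian :=
  Matrix.isHermitian_one.smul (by simp [IsSelfAdjoint])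

theorem abs_plaquetteVec_le (S : Finset (Site d × Fin d)) (p : Site d × Fin d × Fin d) (e : S) :
    |plaquetteVec S p e| ≤ 4 := by
  have h : ∀ f, |(Pi.single e.1 1 : Site d × Fin d → ℝ) f| ≤ 1 := by
    intro f
    rw [Pi.single_apply]
    split_ifs <;> simp
  simp only [plaquetteVec, plaquetteValue]
  have h1 := abs_le.1 (h (p.1, p.2.1))
  have h2 := abs_le.1 (h (p.1 + unit p.2.1, p.2.2))
  have h3 := abs_le.1 (h (p.1 + unit p.2.2, p.2.1))
  have h4 := abs_le.1 (h (p.1, p.2.2))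
  rw [abs_le]
  constructor <;> linarith [h1.1, h1.2, h2.1, h2.2, h3.1, h3.2, h4.1, h4.2]

theorem plaquetteVec_dotProduct_self_le (S : Finset (Site d × Fin d))
    (p : Site d × Fin d × Fin d) : plaquetteVec S p ⬝ᵥ plaquetteVec S p ≤ 16 * S.card := by
  rw [dotProduct]
  refine (Finset.sum_le_card_nsmul Finset.univ _ 16 fun e _ => ?_).trans
    (by simp [mul_comm])
  have := abs_le.1 (abs_plaquetteVec_le S p e)
  nlinarith

/-- Cauchy–Schwarz on each plaquette; `16` is the square of the crude bound `4` on an entry of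
`plaquetteVec`. Polynomial growth in `n` is all that is needed. -/
theorem smul_one_sub_gram_posSemidef (P : Finset (Site d × Fin d × Fin d))
    (S : Finset (Site d × Fin d)) :
    ((16 * P.card * S.card : ℝ) • (1 : Matrix S S ℝ) - gram P S).PosSemidef := by
  refine Matrix.PosSemidef.of_dotProduct_mulVec_nonneg
    ((isHermitian_smul_one _).sub (gram_isHermitian P S)) fun u => ?_
  simp only [star_trivial, sub_mulVec, dotProduct_sub, smul_mulVec, one_mulVec,
    dotProduct_smul, smul_eq_mul, dotProduct_gram_mulVec]
  rw [sub_nonneg]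
  have huu : 0 ≤ u ⬝ᵥ u := by simpa using dotProduct_star_self_nonneg u
  refine (Finset.sum_le_card_nsmul P _ (16 * S.card * (u ⬝ᵥ u)) fun p _ => ?_).trans
    (by rw [nsmul_eq_mul]; exact (by ring : _ = _).le)
  rw [plaquetteValue_extendZero]
  have hcs : (u ⬝ᵥ plaquetteVec S p) ^ 2 ≤
      (u ⬝ᵥ u) * (plaquetteVec S p ⬝ᵥ plaquetteVec S p) := by
    simpa [dotProduct, sq] using Finset.sum_mul_sq_le_sq_mul_sq Finset.univ u (plaquetteVec S p)
  have := mul_le_mul_of_nonneg_left (plaquetteVec_dotProduct_self_le S p) huu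
  linarith

/-- A lower bound for the spectrum of `Σ_n^0`. -/
noncomputable def spectralGap (d n : ℕ) : ℝ := 1 / ((axialEdges d n).card * (d * n : ℝ) ^ 2 + 1)

theorem spectralGap_pos (d n : ℕ) : 0 < spectralGap d n := by
  unfold spectralGap
  positivity

/-- If `q` is the value of the form, every plaquette value is at most `√q`, so every edge value is
at most `d * n * √q` by the axial gauge bound. Summing squares over the edges gives the gap. -/
theorem gram_plaquettes_sub_posSemidef (d n : ℕ) :
    (gram (plaquettes d n) (axialEdges d n) -
      spectralGap d n • (1 : Matrix (axialEdges d n) (axialEdges d n) ℝ)).PosSemidef := by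
  refine Matrix.PosSemidef.of_dotProduct_mulVec_nonneg
    ((gram_isHermitian _ _).sub (isHermitian_smul_one _)) fun u => ?_
  simp only [star_trivial, sub_mulVec, dotProduct_sub, smul_mulVec, one_mulVec,
    dotProduct_smul, smul_eq_mul, dotProduct_gram_mulVec]
  set q := ∑ p ∈ plaquettes d n, plaquetteValue (extendZero (axialEdges d n) u) p ^ 2 with hq
  have hq0 : 0 ≤ q := Finset.sum_nonneg fun p _ => sq_nonneg _
  have hr : ∀ p ∈ plaquettes d n,
      |plaquetteValue (extendZero (axialEdges d n) u) p| ≤ Real.sqrt q := by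
    intro p hp
    refine Real.abs_le_sqrt ?_
    exact Finset.single_le_sum (f := fun p => plaquetteValue (extendZero (axialEdges d n) u) p ^ 2)
      (fun p _ => sq_nonneg _) hp
  have hu0 : ∀ e ∈ treeEdges d n, extendZero (axialEdges d n) u e = 0 := fun e he =>
    extendZero_of_notMem u fun h => (Finset.mem_sdiff.1 h).2 he
  have hle : u ⬝ᵥ u ≤ (axialEdges d n).card * (d * n : ℝ) ^ 2 * q := by
    rw [dotProduct]
    refine (Finset.sum_le_card_nsmul Finset.univ _ ((d * n : ℝ) ^ 2 * q) fun e _ => ?_).trans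
      (by simp [mul_assoc])
    have h := abs_le_of_mem_edges hu0 hr (Real.sqrt_nonneg q) (Finset.mem_sdiff.1 e.2).1
    rw [extendZero_coe] at h
    have h2 := mul_self_le_mul_self (abs_nonneg _) h
    rw [abs_mul_abs_self] at h2
    refine h2.trans (le_of_eq ?_)
    have := Real.mul_self_sqrt hq0
    linear_combination (d * n : ℝ) ^ 2 * this
  rw [sub_nonneg, spectralGap, one_div, inv_mul_le_iff₀ (by positivity)]
  linarith

theorem sigmaZero_posDef (d n : ℕ) : (sigmaZero d n).PosDef := by
  rw [sigmaZero_eq_gram]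
  exact posDef_of_sub_smul_one (spectralGap_pos d n) (gram_plaquettes_sub_posSemidef d n)

theorem gram_outerPlaquettes_eq (d n : ℕ) (S : Finset (Site d × Fin d)) :
    gram (outerPlaquettes d n) S = gram (plaquettes d n) S +
      ∑ p ∈ outerPlaquettes d n \ plaquettes d n,
        Matrix.vecMulVec (plaquetteVec S p) (plaquetteVec S p) := by
  rw [gram, gram, add_comm, Finset.sum_sdiff (plaquettes_subset_outerPlaquettes d n)]

theorem gram_outerPlaquettes_bounds (d n : ℕ) :
    (gram (outerPlaquettes d n) (axialEdges d n) -
      spectralGap d n • (1 : Matrix (axialEdges d n) (axialEdges d n) ℝ)).PosSemidef ∧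
    (sigmaZero d n).det ≤ (gram (outerPlaquettes d n) (axialEdges d n)).det ∧
    (gram (outerPlaquettes d n) (axialEdges d n)).det ≤ (sigmaZero d n).det *
      (1 + 16 * (axialEdges d n).card / spectralGap d n) ^
        (outerPlaquettes d n \ plaquettes d n).card := by
  rw [sigmaZero_eq_gram, gram_outerPlaquettes_eq]
  exact det_add_sum_vecMulVec_bounds (spectralGap_pos d n) (by positivity)
    (gram_plaquettes_sub_posSemidef d n) _ _ fun p _ => plaquetteVec_dotProduct_self_le _ p

theorem det_toBlock_gram (P : Finset (Site d × Fin d × Fin d)) {S W : Finset (Site d × Fin d)}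
    (h : W ⊆ S) :
    ((gram P S).toBlock (fun e => e.1 ∈ W) (fun e => e.1 ∈ W)).det = (gram P W).det := by
  let f : {e : S // e.1 ∈ W} ≃ W :=
    { toFun := fun e => ⟨e.1.1, e.2⟩
      invFun := fun e => ⟨⟨e.1, h e.2⟩, e.2⟩
      left_inv := fun _ => rfl
      right_inv := fun _ => rfl }
  rw [← Matrix.det_submatrix_equiv_self f]
  congr 1
  ext e e'
  simp [Matrix.toBlock, gram_apply, f]

theorem card_notMem (S W : Finset (Site d × Fin d)) :
    Fintype.card {e : S // ¬ e.1 ∈ W} = (S \ W).card := by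
  rw [← Fintype.card_coe]
  exact Fintype.card_congr
    { toFun := fun e => ⟨e.1.1, Finset.mem_sdiff.2 ⟨e.1.2, e.2⟩⟩
      invFun := fun e => ⟨⟨e.1, (Finset.mem_sdiff.1 e.2).1⟩, (Finset.mem_sdiff.1 e.2).2⟩
      left_inv := fun _ => rfl
      right_inv := fun _ => rfl }

theorem det_gram_subset_bounds {n : ℕ} {W : Finset (Site d × Fin d)} (h : W ⊆ axialEdges d n) :
    0 < (gram (outerPlaquettes d n) W).det ∧
    spectralGap d n ^ (axialEdges d n \ W).card * (gram (outerPlaquettes d n) W).det ≤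
      (gram (outerPlaquettes d n) (axialEdges d n)).det ∧
    (gram (outerPlaquettes d n) (axialEdges d n)).det ≤
      (16 * (outerPlaquettes d n).card * (axialEdges d n).card : ℝ) ^ (axialEdges d n \ W).card *
        (gram (outerPlaquettes d n) W).det := by
  have := det_toBlock_bounds (spectralGap_pos d n) (gram_outerPlaquettes_bounds d n).1
    (smul_one_sub_gram_posSemidef _ _) (fun e => e.1 ∈ W)
  rwa [det_toBlock_gram _ h, card_notMem] at this

end Gram

/-! ### The compression of `Q` as a Gram matrix. -/

section Compression

theorem mem_box_of_mem_edges {n : ℕ} {e : Site d × Fin d} (h : e ∈ edges d n) :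
    e.1 ∈ box d n := (mem_edges.1 h).1

theorem gram_outerPlaquettes_apply {n : ℕ} {S : Finset (Site d × Fin d)} (hS : S ⊆ edges d n)
    (e e' : S) :
    gram (outerPlaquettes d n) S e e' = inner ℝ (edgeField e.1) (Q d (edgeField e'.1)) := by
  rw [gram_apply, inner_Q_eq_sum_outerPlaquettes (n := n)]
  · simp only [edgeField_apply]
  · intro i x hx
    rw [edgeField_apply, Pi.single_apply, if_neg]
    intro h
    exact hx (by simpa [← h] using mem_box_of_mem_edges (hS e.2))

theorem mem_axialSpace_iff {n : ℕ} {w : Fields d} :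
    w ∈ axialSpace d n ↔ ∀ i x, (x, i) ∉ axialEdges d n → w i x = 0 := by
  change (∀ i : Fin d, (∀ x, x ∉ box d n → w i x = 0) ∧
    ∀ x ∈ constrainedSites d n i, w i x = 0) ↔ _
  constructor
  · intro h i x hx
    by_cases hb : x ∈ box d n
    · refine (h i).2 x ?_
      simp only [constrainedSites, Finset.mem_union, Finset.mem_filter, boundary]
      by_cases he : (x, i) ∈ edges d n
      · left
        refine ⟨hb, ?_⟩
        by_contra ht
        exact hx (Finset.mem_sdiff.2 ⟨he, ht⟩)
      · right
        -- A site of the box whose `i`-edge leaves the box has `x i = n`, hence lies on the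
        -- boundary.
        refine ⟨⟨hb, i, Or.inr ?_⟩, he⟩
        by_contra hne
        refine he (mem_edges.2 ⟨hb, mem_box.2 fun l => ?_⟩)
        have hl := mem_box.1 hb l
        rw [Pi.add_apply, unit_apply]
        split_ifs with h
        · subst h; omega
        · omega
    · exact (h i).1 x hb
  · intro h i
    refine ⟨fun x hx => h i x fun he => hx ?_, fun x hx => h i x fun he => ?_⟩
    · exact mem_box_of_mem_edges (Finset.mem_sdiff.1 he).1
    · have he' := Finset.mem_sdiff.1 he
      simp only [constrainedSites, Finset.mem_union, Finset.mem_filter] at hx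
      rcases hx with hx | hx
      · exact he'.2 hx.2
      · exact hx.2 he'.1

theorem edgeField_mem_axialSpace {n : ℕ} (e : axialEdges d n) :
    edgeField e.1 ∈ axialSpace d n := by
  rw [mem_axialSpace_iff]
  intro i x hx
  rw [edgeField_apply, Pi.single_apply, if_neg]
  intro h
  exact hx (h ▸ e.2)

theorem orthonormal_edgeField (n : ℕ) :
    Orthonormal ℝ fun e : axialEdges d n =>
      (⟨edgeField e.1, edgeField_mem_axialSpace e⟩ : axialSpace d n) := by
  rw [orthonormal_iff_ite]
  intro e e'
  rw [Submodule.coe_inner, inner_edgeField, edgeField_apply, Pi.single_apply]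
  exact if_congr Subtype.ext_iff.symm rfl rfl

theorem eq_sum_edgeField {n : ℕ} {w : Fields d} (hw : w ∈ axialSpace d n) :
    w = ∑ e : axialEdges d n, w e.1.2 e.1.1 • edgeField e.1 := by
  ext i x
  rw [sum_smul_edgeField_apply (fun e : axialEdges d n => w e.1.2 e.1.1)]
  by_cases h : (x, i) ∈ axialEdges d n
  · rw [extendZero, dif_pos h]
  · rw [extendZero, dif_neg h, mem_axialSpace_iff.1 hw i x h]

/-- The orthonormal basis of `Ω_n^{1,a}` that consists of the unit fields on the edges. -/
noncomputable def axialBasis (d n : ℕ) :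
    OrthonormalBasis (axialEdges d n) ℝ (axialSpace d n) :=
  OrthonormalBasis.mk (orthonormal_edgeField n) (by
    rintro ⟨w, hw⟩ -
    have : (⟨w, hw⟩ : axialSpace d n) = ∑ e : axialEdges d n, w e.1.2 e.1.1 •
        (⟨edgeField e.1, edgeField_mem_axialSpace e⟩ : axialSpace d n) := by
      ext1
      simpa using eq_sum_edgeField hw
    rw [this]
    exact Submodule.sum_mem _ fun e _ => Submodule.smul_mem _ _
      (Submodule.subset_span ⟨e, rfl⟩))

theorem axialBasis_apply (n : ℕ) (e : axialEdges d n) :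
    (axialBasis d n e : Fields d) = edgeField e.1 := by
  rw [axialBasis, OrthonormalBasis.coe_mk]

theorem inner_compression {E : Type*} [NormedAddCommGroup E] [InnerProductSpace ℝ E]
    (V : Submodule ℝ E) [V.HasOrthogonalProjection] (A : E →L[ℝ] E) (v w : V) :
    inner ℝ v (compression V A w) = inner ℝ (v : E) (A w) := by
  change inner ℝ v (V.orthogonalProjectionOnto (A w)) = _
  rw [Submodule.inner_orthogonalProjectionOnto_eq_of_mem_left]

/-- The unit edge fields form an orthonormal basis. The only difference from `sigmaZero` is that
plaquettes sticking out of `Λ_n` are counted too. -/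
theorem det_compression (d n : ℕ) :
    LinearMap.det (compression (axialSpace d n) (Q d)) =
      (gram (outerPlaquettes d n) (axialEdges d n)).det := by
  rw [← LinearMap.det_toMatrix (axialBasis d n).toBasis]
  congr 1
  ext e e'
  rw [gram_outerPlaquettes_apply (S := axialEdges d n) Finset.sdiff_subset, LinearMap.toMatrix_apply,
    OrthonormalBasis.coe_toBasis, OrthonormalBasis.coe_toBasis_repr_apply,
    OrthonormalBasis.repr_apply_apply, inner_compression, axialBasis_apply, axialBasis_apply]

theorem inner_Q_pos_of_mem_axialSpace {n : ℕ} {w : Fields d} (hw : w ∈ axialSpace d n)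
    (h0 : w ≠ 0) : 0 < inner ℝ w (Q d w) := by
  set u : axialEdges d n → ℝ := fun e => w e.1.2 e.1.1 with hu
  have hext : ∀ i x, w i x = extendZero (axialEdges d n) u (x, i) := by
    intro i x
    conv_lhs => rw [eq_sum_edgeField hw]
    rw [sum_smul_edgeField_apply u]
  have hune : u ≠ 0 := by
    intro h
    apply h0
    rw [eq_sum_edgeField hw]
    refine Finset.sum_eq_zero fun e _ => ?_
    rw [show w e.1.2 e.1.1 = 0 from congrFun h e, zero_smul]
  have hpd := (posDef_of_sub_smul_one (spectralGap_pos d n)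
    (gram_outerPlaquettes_bounds d n).1).dotProduct_mulVec_pos hune
  rw [star_trivial, dotProduct_gram_mulVec] at hpd
  rw [inner_Q_eq_sum_outerPlaquettes (n := n) w w]
  · simpa only [hext, sq] using hpd
  · intro i x hx
    exact mem_axialSpace_iff.1 hw i x fun he =>
      hx (mem_box_of_mem_edges (Finset.mem_sdiff.1 he).1)

theorem trLog_compression (d n : ℕ) :
    trLog (compression (axialSpace d n) (Q d)) =
      Real.log (gram (outerPlaquettes d n) (axialEdges d n)).det := by
  rw [trLog_eq_log_det, det_compression]
  · intro v w
    rw [real_inner_comm, inner_compression, inner_compression, Q_symmetric, real_inner_comm]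
  · intro v hv
    rw [inner_compression]
    exact inner_Q_pos_of_mem_axialSpace v.2 (by simpa using hv)

theorem trLog_sigmaZero (d n : ℕ) :
    trLog (Matrix.toEuclideanLin (sigmaZero d n)) = Real.log (sigmaZero d n).det :=
  trLog_toEuclideanLin (sigmaZero_posDef d n)

end Compression

end LatticeMaxwell
namespace LatticeMaxwell

open Matrix

variable {d : ℕ}

/-! ### Exact evaluation of the reference determinant. -/

section ReferenceDeterminant

theorem prod_eq_mul_prod_erase_of_eq_off (f : Fin d → ℤ → ℝ) {x y : Site d} (l : Fin d)
    (h : ∀ m, m ≠ l → y m = x m) :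
    ∏ m, f m (y m) = f l (y l) * ∏ m ∈ Finset.univ.erase l, f m (x m) := by
  rw [← Finset.mul_prod_erase Finset.univ _ (Finset.mem_univ l)]
  congr 1
  exact Finset.prod_congr rfl fun m hm => by rw [h m (Finset.ne_of_mem_erase hm)]

theorem prod_eq_mul_mul_prod_erase_of_eq_off (f : Fin d → ℤ → ℝ) {x y : Site d} {i j : Fin d}
    (hij : i ≠ j) (h : ∀ m, m ≠ i → m ≠ j → y m = x m) :
    ∏ m, f m (y m) =
      f i (y i) * f j (y j) * ∏ m ∈ (Finset.univ.erase i).erase j, f m (x m) := by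
  rw [← Finset.mul_prod_erase Finset.univ _ (Finset.mem_univ i),
    ← Finset.mul_prod_erase (Finset.univ.erase i) _
      (Finset.mem_erase.2 ⟨hij.symm, Finset.mem_univ j⟩), mul_assoc]
  congr 2
  refine Finset.prod_congr rfl fun m hm => ?_
  rw [Finset.mem_erase, Finset.mem_erase] at hm
  rw [h m hm.2.1 hm.1]

variable {n : ℕ}

/-- The symbol `∑ l, (2 - 2 cos(π k_l / n))` of the Laplacian. -/
noncomputable def symbol (n : ℕ) (k : Site d) : ℝ := ∑ l, freq n (k l) ^ 2

theorem fieldMode_eq_zero {j l : Fin d} (hlj : l ≠ j) {k y : Site d} (h : y l = 0 ∨ y l = n) :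
    fieldMode n j k y = 0 := by
  refine Finset.prod_eq_zero (Finset.mem_univ l) ?_
  rw [dirMode, if_neg hlj]
  rcases h with h | h <;> rw [h]
  · exact sinMode_zero _
  · exact sinMode_self _

/-- Only Dirichlet directions are needed: in direction `j` the second difference cancels against
`∂_j ∂_j^*` in `Q`. -/
theorem fieldMode_laplacian {j l : Fin d} (k x : Site d) (hl : l ≠ j) :
    2 * fieldMode n j k x - fieldMode n j k (x + unit l) - fieldMode n j k (x - unit l) =
      freq n (k l) ^ 2 * fieldMode n j k x := by
  have h1 : ∀ m, m ≠ l → (x + unit l) m = x m := fun m hm => by simp [unit_apply, hm]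
  have h2 : ∀ m, m ≠ l → (x - unit l) m = x m := fun m hm => by simp [unit_apply, hm]
  simp only [fieldMode]
  rw [prod_eq_mul_prod_erase_of_eq_off (fun m => dirMode n j m (k m)) l h1,
    prod_eq_mul_prod_erase_of_eq_off (fun m => dirMode n j m (k m)) l h2,
    prod_eq_mul_prod_erase_of_eq_off (fun m => dirMode n j m (k m)) (x := x) (y := x) l
      (fun _ _ => rfl)]
  generalize ∏ m ∈ Finset.univ.erase l, dirMode n j m (k m) (x m) = R
  simp only [dirMode, if_neg hl, Pi.add_apply, Pi.sub_apply, unit_apply, if_true]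
  have := sinMode_laplacian (n := n) (k l) (x l)
  linear_combination R * this

/-- `∂_i` turns the sine in direction `i` into a cosine and `∂_j^*` turns the cosine in direction
`j` into a sine, so a mode of component `j` becomes the mode of component `i` with the same
frequency. This dictates the choice of boundary conditions. -/
theorem fieldMode_mixed {i j : Fin d} (k x : Site d) (hij : i ≠ j) :
    fieldMode n j k (x + unit i - unit j) - fieldMode n j k (x + unit i) -
      fieldMode n j k (x - unit j) + fieldMode n j k x =
      freq n (k i) * freq n (k j) * fieldMode n i k x := by
  have h1 : ∀ m, m ≠ i → m ≠ j → (x + unit i - unit j) m = x m := fun m hm hm' => by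
    simp [unit_apply, hm, hm']
  have h2 : ∀ m, m ≠ i → m ≠ j → (x + unit i) m = x m := fun m hm hm' => by
    simp [unit_apply, hm]
  have h3 : ∀ m, m ≠ i → m ≠ j → (x - unit j) m = x m := fun m hm hm' => by
    simp [unit_apply, hm']
  simp only [fieldMode]
  rw [prod_eq_mul_mul_prod_erase_of_eq_off (fun m => dirMode n j m (k m)) hij h1,
    prod_eq_mul_mul_prod_erase_of_eq_off (fun m => dirMode n j m (k m)) hij h2,
    prod_eq_mul_mul_prod_erase_of_eq_off (fun m => dirMode n j m (k m)) hij h3,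
    prod_eq_mul_mul_prod_erase_of_eq_off (fun m => dirMode n j m (k m)) (x := x) (y := x) hij
      (fun _ _ _ => rfl),
    prod_eq_mul_mul_prod_erase_of_eq_off (fun m => dirMode n i m (k m)) (x := x) (y := x) hij
      (fun _ _ _ => rfl)]
  have hR : ∏ m ∈ (Finset.univ.erase i).erase j, dirMode n i m (k m) (x m) =
      ∏ m ∈ (Finset.univ.erase i).erase j, dirMode n j m (k m) (x m) := by
    refine Finset.prod_congr rfl fun m hm => ?_
    rw [Finset.mem_erase, Finset.mem_erase] at hm
    rw [dirMode, dirMode, if_neg hm.2.1, if_neg hm.1]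
  rw [hR]
  generalize ∏ m ∈ (Finset.univ.erase i).erase j, dirMode n j m (k m) (x m) = R
  simp only [dirMode, if_neg hij, if_neg hij.symm, Pi.add_apply, Pi.sub_apply, unit_apply,
    if_true, add_zero, sub_zero]
  have e1 := sinMode_add_one_sub (n := n) (k i) (x i)
  have e2 := cosMode_sub_one_sub (n := n) (k j) (x j)
  linear_combination R * ((cosMode n (k j) (x j - 1) - cosMode n (k j) (x j)) * e1 +
    freq n (k i) * cosMode n (k i) (x i) * e2)

theorem Q_apply_apply (w : Fields d) (i : Fin d) (x : Site d) :
    Q d w i x = ∑ l, (2 * w i x - w i (x + unit l) - w i (x - unit l)) -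
      ∑ l, (w l (x + unit i - unit l) - w l (x + unit i) - w l (x - unit l) + w l x) := by
  rw [Q_apply, lp.coeFn_sub, Pi.sub_apply, lp.coeFn_sum, lp.coeFn_sum, Finset.sum_apply,
    Finset.sum_apply]
  congr 1
  · refine Finset.sum_congr rfl fun l _ => ?_
    rw [partialStar_apply, partialD_apply, partialD_apply, sub_add_cancel]
    ring
  · refine Finset.sum_congr rfl fun l _ => ?_
    rw [partialD_apply, partialStar_apply, partialStar_apply]
    ring

/-- The field with the column `q` of `modeMatrix` as its values. -/
noncomputable def modeField (n : ℕ) (o : Fin d) (q : refEdges n o) : Fields d :=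
  ∑ e : refEdges n o, modeMatrix n o e q • edgeField e.1

theorem modeField_of_ne {o i : Fin d} (q : refEdges n o) (hi : i ≠ q.1.2) (y : Site d) :
    modeField n o q i y = 0 := by
  rw [modeField, sum_smul_edgeField_apply (fun e => modeMatrix n o e q), extendZero]
  split_ifs
  · simp [modeMatrix, hi]
  · rfl

/-- The sine factors vanish at `0` and `n`, so the truncated field still agrees with the mode on the
Dirichlet faces. -/
theorem modeField_apply {o : Fin d} (q : refEdges n o) {y : Site d}
    (hy : ∀ l, 0 ≤ y l ∧ y l ≤ n) (hyj : y q.1.2 < n) :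
    modeField n o q q.1.2 y = fieldMode n q.1.2 q.1.1 y := by
  have hq := mem_refEdges.1 q.2
  rw [modeField, sum_smul_edgeField_apply (fun e => modeMatrix n o e q), extendZero]
  split_ifs with h
  · simp [modeMatrix]
  · have h' : ¬ y ∈ modeBox n q.1.2 := fun hm => h (mem_refEdges.2 ⟨hq.1, hm⟩)
    rw [mem_modeBox] at h'
    push Not at h'
    obtain ⟨l, hl⟩ := h'
    have h1 := hy l
    by_cases hlj : l = q.1.2
    · subst hlj
      have := (hl h1.1 hyj).1
      exact absurd rfl this
    · refine (fieldMode_eq_zero hlj ?_).symm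
      by_cases h2 : y l < n
      · have := (hl h1.1 h2).2
        omega
      · omega

/-- At the reference edges the truncation is invisible to `Q`, and the mode identities apply. The
term `i = j` of `∂_i ∂_j^*` is kept explicit so that the result has the form `D - G Gᵀ`. -/
theorem Q_modeField {o : Fin d} (e q : refEdges n o) :
    Q d (modeField n o q) e.1.2 e.1.1 =
      (if e.1.2 = q.1.2 then symbol n q.1.1 * fieldMode n e.1.2 q.1.1 e.1.1 else 0) -
        freq n (q.1.1 e.1.2) * freq n (q.1.1 q.1.2) * fieldMode n e.1.2 q.1.1 e.1.1 := by
  have he := (mem_refEdges.1 e.2).2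
  rw [mem_modeBox] at he
  set i := e.1.2 with hi
  set x := e.1.1 with hx
  set j := q.1.2 with hj
  set k := q.1.1 with hk
  set w := modeField n o q with hw
  -- The sites that will be evaluated: one step in Dirichlet directions, and in the Neumann
  -- direction `j` only a step down, taken only if `i ≠ j`, when `x j ≥ 1`.
  have hbox : ∀ (y : Site d), (∀ l, y l = x l ∨ (l ≠ j ∧ x l ≠ 0 ∧ y l = x l - 1) ∨
      (l ≠ j ∧ x l < n ∧ y l = x l + 1) ∨ (l = j ∧ i ≠ j ∧ y l = x l - 1)) →
      w j y = fieldMode n j k y := by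
    intro y hy
    refine modeField_apply q (fun l => ?_) ?_
    · have h1 := he l
      rcases hy l with h | h | h | h
      · omega
      · omega
      · omega
      · obtain ⟨rfl, h2, h3⟩ := h
        have := h1.2.2 h2.symm
        omega
    · have h1 := he j
      rcases hy j with h | h | h | h
      · change y j < n; omega
      · exact absurd rfl h.1
      · exact absurd rfl h.1
      · change y j < n; omega
  have hx0 : w j x = fieldMode n j k x := hbox x fun l => Or.inl rfl
  rw [Q_apply_apply]
  rw [Finset.sum_eq_single (s := Finset.univ) (f := fun l => w l (x + unit i - unit l) -
    w l (x + unit i) - w l (x - unit l) + w l x) j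
    (fun l _ hl => by simp only [hw, modeField_of_ne q hl]; ring) (by simp)]
  by_cases hij : i = j
  -- For `i = j` the second difference in direction `j` occurs in both sums and cancels, so values
  -- beyond the Neumann ends play no role.
  · rw [hij, if_pos rfl, add_sub_cancel_right, symbol,
      ← Finset.add_sum_erase _ (fun l => freq n (k l) ^ 2) (Finset.mem_univ j),
      ← Finset.add_sum_erase _ (fun l => 2 * w j x - w j (x + unit l) - w j (x - unit l))
        (Finset.mem_univ j)]
    have : ∑ l ∈ Finset.univ.erase j, (2 * w j x - w j (x + unit l) - w j (x - unit l)) =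
        (∑ l ∈ Finset.univ.erase j, freq n (k l) ^ 2) * fieldMode n j k x := by
      rw [Finset.sum_mul]
      refine Finset.sum_congr rfl fun l hl => ?_
      have hlj := Finset.ne_of_mem_erase hl
      rw [← fieldMode_laplacian k x hlj, hx0, hbox, hbox]
      · intro m
        rw [Pi.sub_apply, unit_apply]
        split_ifs with h
        · subst h
          have := (he m).2.2 (hij ▸ hlj)
          exact Or.inr (Or.inl ⟨hlj, by omega, rfl⟩)
        · exact Or.inl (sub_zero _)
      · intro m
        rw [Pi.add_apply, unit_apply]
        split_ifs with h
        · subst h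
          exact Or.inr (Or.inr (Or.inl ⟨hlj, (he m).2.1, rfl⟩))
        · exact Or.inl (add_zero _)
    rw [this]
    ring
  · have hzero : ∀ y, w i y = 0 := modeField_of_ne q hij
    have hi1 : ∀ m, (x + unit i) m = x m ∨ (m ≠ j ∧ x m < n ∧ (x + unit i) m = x m + 1) := by
      intro m
      rw [Pi.add_apply, unit_apply]
      split_ifs with h
      · subst h
        exact Or.inr ⟨hij, (he _).2.1, rfl⟩
      · exact Or.inl (add_zero _)
    simp only [hzero, if_neg hij]
    rw [hx0, hbox (x + unit i - unit j), hbox (x + unit i), hbox (x - unit j),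
      fieldMode_mixed k x hij]
    · simp
    · intro m
      rw [Pi.sub_apply, unit_apply]
      split_ifs with h
      · exact Or.inr (Or.inr (Or.inr ⟨h, hij, rfl⟩))
      · exact Or.inl (sub_zero _)
    · intro m
      rcases hi1 m with h | h
      · exact Or.inl h
      · exact Or.inr (Or.inr (Or.inl h))
    · intro m
      rw [Pi.sub_apply, unit_apply]
      split_ifs with h
      · refine Or.inr (Or.inr (Or.inr ⟨h, hij, ?_⟩))
        rcases hi1 m with h' | h'
        · rw [h']
        · exact absurd h h'.1
      · rw [sub_zero]
        rcases hi1 m with h' | h'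
        · exact Or.inl h'
        · exact Or.inr (Or.inr (Or.inl h'))

theorem refEdges_subset_edges (n : ℕ) (o : Fin d) : refEdges n o ⊆ edges d n := by
  rintro ⟨x, i⟩ h
  have hx : ∀ l, 0 ≤ x l ∧ x l < n ∧ (l ≠ i → 1 ≤ x l) := mem_modeBox.1 (mem_refEdges.1 h).2
  refine mem_edges.2 ⟨mem_box.2 fun l => ⟨(hx l).1, (hx l).2.1.le⟩, mem_box.2 fun l => ?_⟩
  have := hx l
  rw [Pi.add_apply, unit_apply]
  split_ifs <;> omega

theorem gram_mul_modeMatrix {o : Fin d} (e q : refEdges n o) :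
    (gram (outerPlaquettes d n) (refEdges n o) * modeMatrix n o) e q =
      Q d (modeField n o q) e.1.2 e.1.1 := by
  rw [Matrix.mul_apply, ← inner_edgeField, modeField, map_sum, inner_sum]
  refine Finset.sum_congr rfl fun e' _ => ?_
  rw [gram_outerPlaquettes_apply (refEdges_subset_edges n o), map_smul, inner_smul_right, mul_comm]

/-- The sites strictly inside `Λ_n`. -/
noncomputable def innerBox (d n : ℕ) : Finset (Site d) :=
  Fintype.piFinset fun _ => Finset.Ico 1 (n : ℤ)

theorem mem_innerBox {x : Site d} : x ∈ innerBox d n ↔ ∀ l, 1 ≤ x l ∧ x l < n := by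
  simp [innerBox]

theorem innerBox_subset_modeBox (i : Fin d) : innerBox d n ⊆ modeBox n i := by
  intro x hx
  rw [mem_innerBox] at hx
  exact mem_modeBox.2 fun l => ⟨by linarith [(hx l).1], (hx l).2, fun _ => (hx l).1⟩

/-- The lattice gradient in terms of modes. -/
noncomputable def modeGradient (n : ℕ) (o : Fin d) : Matrix (refEdges n o) (innerBox d n) ℝ :=
  Matrix.of fun q l => if q.1.1 = l.1 then freq n (q.1.1 q.1.2) else 0

theorem sum_coe_refEdges {o : Fin d} (f : Site d × Fin d → ℝ) :
    ∑ e : refEdges n o, f e.1 = ∑ i ∈ Finset.univ.erase o, ∑ x ∈ modeBox n i, f (x, i) := by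
  rw [Finset.sum_coe_sort, sum_refEdges]

theorem modeMatrix_mul_modeGradient {o : Fin d} (e : refEdges n o) (l : innerBox d n) :
    (modeMatrix n o * modeGradient n o) e l =
      freq n (l.1 e.1.2) * fieldMode n e.1.2 l.1 e.1.1 := by
  have he := mem_refEdges.1 e.2
  rw [Matrix.mul_apply]
  simp only [modeMatrix, modeGradient, Matrix.of_apply]
  rw [sum_coe_refEdges (fun q => (if e.1.2 = q.2 then fieldMode n e.1.2 q.1 e.1.1 else 0) *
    (if q.1 = l.1 then freq n (q.1 q.2) else 0)), Finset.sum_eq_single e.1.2,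
    Finset.sum_eq_single l.1]
  · simp [mul_comm]
  · intro x _ hx
    simp [hx]
  · intro h
    exact absurd (innerBox_subset_modeBox _ l.2) h
  · intro i _ hi
    simp [hi.symm]
  · intro h
    exact absurd (Finset.mem_erase.2 ⟨he.1, Finset.mem_univ _⟩) h

theorem gram_mul_modeMatrix_eq (o : Fin d) :
    gram (outerPlaquettes d n) (refEdges n o) * modeMatrix n o =
      modeMatrix n o * (Matrix.diagonal (fun q : refEdges n o => symbol n q.1.1) +
        modeGradient n o * -(modeGradient n o)ᵀ) := by
  rw [Matrix.mul_add, ← Matrix.mul_assoc]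
  ext e q
  have hq := mem_refEdges.1 q.2
  rw [gram_mul_modeMatrix, Q_modeField, Matrix.add_apply, Matrix.mul_diagonal, sub_eq_add_neg]
  congr 1
  · simp only [modeMatrix, Matrix.of_apply]
    split_ifs with h
    · exact mul_comm _ _
    · simp
  · rw [Matrix.mul_apply]
    simp only [modeMatrix_mul_modeGradient, Matrix.neg_apply, Matrix.transpose_apply]
    simp only [modeGradient, Matrix.of_apply]
    rw [Finset.sum_coe_sort (innerBox d n) (fun l => freq n (l e.1.2) * fieldMode n e.1.2 l e.1.1 *
      -(if q.1.1 = l then freq n (q.1.1 q.1.2) else 0))]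
    by_cases h : q.1.1 ∈ innerBox d n
    · rw [Finset.sum_eq_single_of_mem _ h]
      · simp only [if_true]
        ring
      · intro l _ hl
        simp [hl.symm]
    · rw [Finset.sum_eq_zero]
      -- A frequency outside `innerBox` can only fail in its own Neumann direction, where it is `0`;
      -- its gradient entry vanishes.
      · have hz : q.1.1 q.1.2 = 0 := by
          by_contra hne
          refine h (mem_innerBox.2 fun l => ?_)
          have := mem_modeBox.1 hq.2 l
          by_cases hl : l = q.1.2
          · subst hl; omega
          · exact ⟨this.2.2 hl, this.2.1⟩
        rw [hz, freq_zero]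
        ring
      · intro l hl
        have : q.1.1 ≠ l := fun h' => h (h' ▸ hl)
        simp [this]

theorem freq_pos {k : ℤ} (hk : 1 ≤ k) (hkn : k < n) : 0 < freq n k := by
  have hn : (0 : ℝ) < n := by
    have : 0 < (n : ℤ) := by omega
    exact_mod_cast this
  have h0 : (0 : ℝ) < k := by exact_mod_cast (show 0 < k by omega)
  have h1 : (k : ℝ) < n := by exact_mod_cast hkn
  have hpi := Real.pi_pos
  refine mul_pos two_pos (Real.sin_pos_of_pos_of_lt_pi (by positivity) ?_)
  rw [div_lt_iff₀ (by positivity)]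
  nlinarith

theorem freq_sq_le_symbol (k : Site d) (l : Fin d) : freq n (k l) ^ 2 ≤ symbol n k :=
  Finset.single_le_sum (f := fun l => freq n (k l) ^ 2) (fun _ _ => sq_nonneg _)
    (Finset.mem_univ l)

theorem symbol_pos {k : Site d} {l : Fin d} (h1 : 1 ≤ k l) (h2 : k l < n) : 0 < symbol n k :=
  lt_of_lt_of_le (pow_pos (freq_pos h1 h2) 2) (freq_sq_le_symbol k l)

theorem symbol_pos_of_mem_modeBox {i o : Fin d} (hi : i ≠ o) {k : Site d}
    (hk : k ∈ modeBox n i) : 0 < symbol n k :=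
  symbol_pos ((mem_modeBox.1 hk o).2.2 hi.symm) (mem_modeBox.1 hk o).2.1

/-- The mode determinant cancels, and the Weinstein–Aronszajn identity reduces the rank-deficient
correction to a matrix indexed by interior frequencies. That matrix is diagonal, since the gradient
preserves the frequency, and omitting `o` from the sum leaves exactly `freq_o² / symbol`. -/
theorem det_gram_refEdges (o : Fin d) :
    (gram (outerPlaquettes d n) (refEdges n o)).det =
      (∏ q : refEdges n o, symbol n q.1.1) *
        ∏ l : innerBox d n, (freq n (l.1 o) ^ 2 / symbol n l.1) := by
  have hpos : ∀ q : refEdges n o, symbol n q.1.1 ≠ 0 := fun q =>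
    (symbol_pos_of_mem_modeBox (mem_refEdges.1 q.2).1 (mem_refEdges.1 q.2).2).ne'
  have h := congrArg Matrix.det (gram_mul_modeMatrix_eq (n := n) o)
  rw [Matrix.det_mul, Matrix.det_mul, mul_comm] at h
  rw [mul_left_cancel₀ (det_modeMatrix_ne_zero o) h, Matrix.det_add_mul, Matrix.det_diagonal]
  · congr 1
    rw [← Matrix.det_diagonal]
    congr 1
    have hinv : (Matrix.diagonal (fun q : refEdges n o => symbol n q.1.1))⁻¹ =
        Matrix.diagonal fun q : refEdges n o => (symbol n q.1.1)⁻¹ := by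
      refine Matrix.inv_eq_right_inv ?_
      rw [Matrix.diagonal_mul_diagonal, ← Matrix.diagonal_one]
      congr 1
      funext q
      exact mul_inv_cancel₀ (hpos q)
    ext l l'
    have hl : symbol n l.1 ≠ 0 :=
      (symbol_pos (mem_innerBox.1 l.2 o).1 (mem_innerBox.1 l.2 o).2).ne'
    rw [hinv, Matrix.add_apply, Matrix.mul_apply]
    simp only [Matrix.mul_diagonal, Matrix.neg_apply, Matrix.transpose_apply, modeGradient,
      Matrix.of_apply]
    rw [sum_coe_refEdges (fun q => -(if q.1 = l.1 then freq n (q.1 q.2) else 0) *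
      (symbol n q.1)⁻¹ * (if q.1 = l'.1 then freq n (q.1 q.2) else 0))]
    have hinner : ∀ i, ∑ x ∈ modeBox n i, (-(if x = l.1 then freq n (x i) else 0) *
        (symbol n x)⁻¹ * (if x = l'.1 then freq n (x i) else 0)) =
        if l = l' then -(freq n (l.1 i) ^ 2 / symbol n l.1) else 0 := by
      intro i
      rw [Finset.sum_eq_single_of_mem l.1 (innerBox_subset_modeBox i l.2)]
      · simp only [if_true, ← Subtype.ext_iff]
        split_ifs
        · rw [div_eq_mul_inv]; ring
        · ring
      · intro x _ hx
        simp [hx]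
    simp only [hinner]
    rw [Matrix.one_apply, Matrix.diagonal_apply]
    split_ifs with hll
    · have hs : symbol n l.1 = freq n (l.1 o) ^ 2 +
          ∑ i ∈ Finset.univ.erase o, freq n (l.1 i) ^ 2 :=
        (Finset.add_sum_erase _ _ (Finset.mem_univ o)).symm
      rw [Finset.sum_neg_distrib, ← Finset.sum_div]
      field_simp
      linarith
    · simp
  · rw [Matrix.det_diagonal]
    exact isUnit_iff_ne_zero.2 (Finset.prod_ne_zero_iff.2 fun q _ => hpos q)

theorem log_det_gram_refEdges (o : Fin d) :
    Real.log (gram (outerPlaquettes d n) (refEdges n o)).det =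
      ∑ i ∈ Finset.univ.erase o, ∑ k ∈ modeBox n i, Real.log (symbol n k) +
        (∑ k ∈ innerBox d n, Real.log (freq n (k o) ^ 2) -
          ∑ k ∈ innerBox d n, Real.log (symbol n k)) := by
  have hpos : ∀ q : refEdges n o, symbol n q.1.1 ≠ 0 := fun q =>
    (symbol_pos_of_mem_modeBox (mem_refEdges.1 q.2).1 (mem_refEdges.1 q.2).2).ne'
  have hpos' : ∀ k ∈ innerBox d n, symbol n k ≠ 0 := fun k hk =>
    (symbol_pos (mem_innerBox.1 hk o).1 (mem_innerBox.1 hk o).2).ne'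
  have hpos'' : ∀ k ∈ innerBox d n, freq n (k o) ^ 2 ≠ 0 := fun k hk =>
    (pow_pos (freq_pos (mem_innerBox.1 hk o).1 (mem_innerBox.1 hk o).2) 2).ne'
  rw [det_gram_refEdges, Real.log_mul, Real.log_prod (fun q _ => hpos q),
    Real.log_prod (fun l _ => div_ne_zero (hpos'' _ l.2) (hpos' _ l.2)),
    sum_coe_refEdges (fun q => Real.log (symbol n q.1)),
    Finset.sum_coe_sort (innerBox d n) (fun k => Real.log (freq n (k o) ^ 2 / symbol n k)),
    ← Finset.sum_sub_distrib]
  · congr 1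
    exact Finset.sum_congr rfl fun k hk => Real.log_div (hpos'' k hk) (hpos' k hk)
  · exact Finset.prod_ne_zero_iff.2 fun q _ => hpos q
  · exact Finset.prod_ne_zero_iff.2 fun l _ => div_ne_zero (hpos'' _ l.2) (hpos' _ l.2)

end ReferenceDeterminant

end LatticeMaxwell
namespace LatticeMaxwell

open MeasureTheory Filter Topology

variable {d : ℕ}

/-! ### Riemann sums with boundary singularities. -/

section RiemannSums

theorem volume_restrict_cube :
    (volume.restrict (Set.Icc (0 : Fin d → ℝ) 1)) =
      Measure.pi fun _ : Fin d => (volume.restrict (Set.Icc (0 : ℝ) 1)) := by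
  rw [← Measure.restrict_pi_pi, ← volume_pi, Set.pi_univ_Icc]
  rfl

instance : IsProbabilityMeasure (volume.restrict (Set.Icc (0 : ℝ) 1)) :=
  ⟨by simp⟩

instance : IsProbabilityMeasure (volume.restrict (Set.Icc (0 : Fin d → ℝ) 1)) := by
  rw [volume_restrict_cube]
  infer_instance

/-- The lattice cell of side `1 / n` with upper corner `k / n`. -/
def cell (n : ℕ) (k : Site d) : Set (Fin d → ℝ) :=
  Set.univ.pi fun j => Set.Ioc (((k j : ℝ) - 1) / n) ((k j : ℝ) / n)

theorem measurableSet_cell (n : ℕ) (k : Site d) : MeasurableSet (cell n k) :=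
  MeasurableSet.univ_pi fun _ => measurableSet_Ioc

theorem volume_real_cell {n : ℕ} (k : Site d) : volume.real (cell n k) = (1 / (n : ℝ)) ^ d := by
  rw [Measure.real, cell, Real.volume_pi_Ioc_toReal]
  · have : ∀ j, (k j : ℝ) / n - ((k j : ℝ) - 1) / n = 1 / n := fun j => by ring
    simp [this]
  · intro j
    change ((k j : ℝ) - 1) / n ≤ (k j : ℝ) / n
    gcongr
    linarith

theorem mem_cell_iff {n : ℕ} (hn : 0 < n) (k : Site d) (x : Fin d → ℝ) :
    x ∈ cell n k ↔ k = fun j => ⌈n * x j⌉ := by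
  have hn' : (0 : ℝ) < n := by exact_mod_cast hn
  rw [funext_iff]
  simp only [cell, Set.mem_pi, Set.mem_univ, true_implies, Set.mem_Ioc]
  refine forall_congr' fun j => ?_
  rw [div_lt_iff₀ hn', le_div_iff₀ hn', mul_comm (x j), eq_comm, Int.ceil_eq_iff]

theorem cell_subset {n : ℕ} {k : Site d} (hk : k ∈ innerBox d n) :
    cell n k ⊆ Set.univ.pi fun _ => Set.Ioo 0 1 := by
  intro x hx j _
  have hkj := mem_innerBox.1 hk j
  have hn : (0 : ℝ) < n := by exact_mod_cast (show 0 < (n : ℤ) by omega)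
  have h1 : (1 : ℝ) ≤ k j := by exact_mod_cast hkj.1
  have h2 : (k j : ℝ) < n := by exact_mod_cast hkj.2
  have hxj := hx j (Set.mem_univ j)
  refine ⟨lt_of_le_of_lt ?_ hxj.1, lt_of_le_of_lt hxj.2 ?_⟩
  · exact div_nonneg (by linarith) hn.le
  · rwa [div_lt_one hn]

theorem tendsto_ceil_mul_div (x : ℝ) :
    Tendsto (fun n : ℕ => (⌈(n : ℝ) * x⌉ : ℝ) / n) atTop (𝓝 x) := by
  have h2 : Tendsto (fun n : ℕ => x + 1 / (n : ℝ)) atTop (𝓝 x) := by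
    simpa using (tendsto_const_nhds (x := x)).add
      (tendsto_one_div_atTop_nhds_zero_nat (𝕜 := ℝ))
  refine tendsto_of_tendsto_of_tendsto_of_le_of_le' tendsto_const_nhds h2 ?_ ?_
  · filter_upwards [eventually_gt_atTop 0] with n hn
    have hn' : (0 : ℝ) < n := by exact_mod_cast hn
    rw [le_div_iff₀ hn', mul_comm]
    exact Int.le_ceil _
  · filter_upwards [eventually_gt_atTop 0] with n hn
    have hn' : (0 : ℝ) < n := by exact_mod_cast hn
    rw [div_le_iff₀ hn', add_mul, one_div_mul_cancel hn'.ne', mul_comm]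
    exact (Int.ceil_lt_add_one _).le

/-- Convergence of the Riemann sums of a coordinatewise monotone function that is integrable on
the unit cube but may be unbounded below near its boundary. -/
theorem tendsto_riemann_sum (o : Fin d) {f : (Fin d → ℝ) → ℝ} {C : ℝ}
    (hint : IntegrableOn f (Set.Icc 0 1))
    (hmono : ∀ x y : Fin d → ℝ, (∀ j, 0 < x j) → x ≤ y → (∀ j, y j ≤ 1) → f x ≤ f y)
    (hbdd : ∀ x : Fin d → ℝ, f x ≤ C)
    (hcont : ∀ x : Fin d → ℝ, (∀ j, 0 < x j ∧ x j < 1) → ContinuousAt f x) :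
    Tendsto (fun n : ℕ => (∑ k ∈ innerBox d n, f fun j => (k j : ℝ) / n) / (n : ℝ) ^ d) atTop
      (𝓝 (∫ x in Set.Icc 0 1, f x)) := by
  classical
  set U : Set (Fin d → ℝ) := Set.univ.pi fun _ => Set.Ioo 0 1 with hU
  have hUIcc : U =ᵐ[volume] Set.Icc (0 : Fin d → ℝ) 1 := Measure.univ_pi_Ioo_ae_eq_Icc
  have hUm : MeasurableSet U := MeasurableSet.univ_pi fun _ => measurableSet_Ioo
  have hfU : IntegrableOn f U := hint.congr_set_ae hUIcc
  have hUpos : ∀ x ∈ U, ∀ j, 0 < x j ∧ x j < 1 := fun x hx j => hx j (Set.mem_univ j)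
  -- The step function that takes on each cell the value of `f` at the upper corner; its integral is
  -- the Riemann sum.
  let F : ℕ → (Fin d → ℝ) → ℝ := fun n x =>
    ∑ k ∈ innerBox d n, (cell n k).indicator (fun _ => f fun j => (k j : ℝ) / n) x
  have hF : ∀ {n : ℕ}, 0 < n → ∀ x, F n x =
      if (fun j => ⌈(n : ℝ) * x j⌉) ∈ innerBox d n
        then f fun j => (⌈(n : ℝ) * x j⌉ : ℝ) / n else 0 := by
    intro n hn x
    simp only [F, Set.indicator_apply, mem_cell_iff hn]
    split_ifs with h
    · rw [Finset.sum_eq_single_of_mem _ h]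
      · rw [if_pos rfl]
      · intro k _ hk
        rw [if_neg hk]
    · refine Finset.sum_eq_zero fun k hk => if_neg ?_
      rintro rfl
      exact h hk
  have hintF : ∀ n, ∫ x in U, F n x =
      (∑ k ∈ innerBox d n, f fun j => (k j : ℝ) / n) / (n : ℝ) ^ d := by
    intro n
    rw [integral_finsetSum, Finset.sum_div]
    · refine Finset.sum_congr rfl fun k hk => ?_
      rw [integral_indicator_const _ (measurableSet_cell n k), measureReal_restrict_apply
        (measurableSet_cell n k), Set.inter_eq_left.2 (cell_subset hk), volume_real_cell,
        smul_eq_mul, one_div, inv_pow, div_eq_mul_inv, mul_comm]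
    · intro k _
      have : IsFiniteMeasure (volume.restrict U) := by
        rw [Measure.restrict_congr_set hUIcc]
        infer_instance
      exact (integrable_const _).indicator (measurableSet_cell n k)
  rw [← setIntegral_congr_set hUIcc]
  simp only [← hintF]
  refine tendsto_integral_of_dominated_convergence (fun x => |f x| + |C|) ?_ ?_ ?_ ?_
  · intro n
    refine Measurable.aestronglyMeasurable ?_
    exact Finset.measurable_sum _ fun k _ =>
      measurable_const.indicator (measurableSet_cell n k)
  · have : IsFiniteMeasure (volume.restrict U) := by
      rw [Measure.restrict_congr_set hUIcc]
      infer_instance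
    exact hfU.abs.add (integrable_const _)
  · intro n
    refine (ae_restrict_iff' hUm).2 (Eventually.of_forall fun x hx => ?_)
    have hx := hUpos x hx
    -- For `n = 0` the index set is empty, because the coordinate `o` exists.
    rcases Nat.eq_zero_or_pos n with rfl | hn
    · have hF0 : F 0 x = 0 := Finset.sum_eq_zero fun k hk => by
        have := mem_innerBox.1 hk o
        omega
      rw [hF0, norm_zero]
      positivity
    rw [hF hn]
    split_ifs with h
    · have hn' : (0 : ℝ) < n := by exact_mod_cast hn
      rw [mem_innerBox] at h
      -- The upper corner dominates `x`, so by monotonicity `f x` bounds the step function from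
      -- below; `C` bounds it from above.
      have h1 : f x ≤ f fun j => (⌈(n : ℝ) * x j⌉ : ℝ) / n := by
        refine hmono _ _ (fun j => (hx j).1) (fun j => ?_) fun j => ?_
        · change x j ≤ (⌈(n : ℝ) * x j⌉ : ℝ) / n
          rw [le_div_iff₀ hn', mul_comm]
          exact Int.le_ceil _
        · rw [div_le_one hn']
          exact_mod_cast (h j).2.le
      have h2 := hbdd fun j => (⌈(n : ℝ) * x j⌉ : ℝ) / n
      rw [Real.norm_eq_abs, abs_le]
      constructor
      · linarith [neg_abs_le (f x), abs_nonneg C]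
      · linarith [le_abs_self C, abs_nonneg (f x)]
    · rw [norm_zero]
      positivity
  · refine (ae_restrict_iff' hUm).2 (Eventually.of_forall fun x hx => ?_)
    have hx := hUpos x hx
    have hlim : Tendsto (fun n : ℕ => f fun j => (⌈(n : ℝ) * x j⌉ : ℝ) / n) atTop (𝓝 (f x)) :=
      (hcont x hx).tendsto.comp (tendsto_pi_nhds.2 fun j => tendsto_ceil_mul_div (x j))
    refine hlim.congr' ?_
    -- Once `n (1 - x j) ≥ 1` for all `j`, the cell of `x` is one of those in the sum.
    have hev : ∀ᶠ n : ℕ in atTop, ∀ j, 1 ≤ (n : ℝ) * (1 - x j) := by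
      rw [eventually_all]
      intro j
      have : Tendsto (fun n : ℕ => (n : ℝ) * (1 - x j)) atTop atTop :=
        tendsto_natCast_atTop_atTop.atTop_mul_const (by linarith [(hx j).2])
      exact this.eventually_ge_atTop 1
    filter_upwards [hev, eventually_gt_atTop 0] with n hn hn0
    have hn' : (0 : ℝ) < n := by exact_mod_cast hn0
    rw [hF hn0, if_pos]
    refine mem_innerBox.2 fun j => ⟨?_, ?_⟩
    · exact Int.one_le_ceil_iff.2 (mul_pos hn' (hx j).1)
    · have h1 := Int.ceil_lt_add_one ((n : ℝ) * x j)
      have h2 := hn j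
      have : (⌈(n : ℝ) * x j⌉ : ℝ) < (n : ℝ) := by linarith
      exact_mod_cast this

end RiemannSums

/-! ### Logarithmic integrals and the tent map. -/

section Integrals

theorem measurePreserving_eval_cube (j : Fin d) :
    MeasurePreserving (Function.eval j) (volume.restrict (Set.Icc (0 : Fin d → ℝ) 1))
      (volume.restrict (Set.Icc (0 : ℝ) 1)) := by
  rw [volume_restrict_cube]
  exact measurePreserving_eval _ j

/-- The tent map. -/
noncomputable def tent (x : ℝ) : ℝ := 1 - |2 * x - 1|

theorem continuous_tent : Continuous tent := by
  unfold tent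
  fun_prop

/-- For `0 ≤ a < 1` the preimage of `(-∞, a]` consists of two intervals of length `a / 2`. The map
transfers integrals over half a period of the cosine to a full period. -/
theorem measurePreserving_tent :
    MeasurePreserving tent (volume.restrict (Set.Icc (0 : ℝ) 1))
      (volume.restrict (Set.Icc (0 : ℝ) 1)) := by
  refine ⟨continuous_tent.measurable, ?_⟩
  have : IsFiniteMeasure (Measure.map tent (volume.restrict (Set.Icc (0 : ℝ) 1))) :=
    Measure.isFiniteMeasure_map _ _
  refine Measure.ext_of_Iic _ _ fun a => ?_
  rw [Measure.map_apply continuous_tent.measurable measurableSet_Iic,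
    Measure.restrict_apply (continuous_tent.measurable measurableSet_Iic),
    Measure.restrict_apply measurableSet_Iic]
  rcases lt_or_ge a 0 with ha | ha
  · have h1 : tent ⁻¹' Set.Iic a ∩ Set.Icc 0 1 = ∅ := by
      rw [Set.eq_empty_iff_forall_notMem]
      rintro x ⟨h, h0, h1⟩
      have h : 1 - |2 * x - 1| ≤ a := h
      have : |2 * x - 1| ≤ 1 := abs_le.2 ⟨by linarith, by linarith⟩
      linarith
    have h2 : Set.Iic a ∩ Set.Icc (0 : ℝ) 1 = ∅ := by
      rw [Set.eq_empty_iff_forall_notMem]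
      rintro x ⟨h, h0, h1⟩
      have h : x ≤ a := h
      linarith
    rw [h1, h2]
  rcases le_or_gt 1 a with ha1 | ha1
  · have h1 : tent ⁻¹' Set.Iic a ∩ Set.Icc 0 1 = Set.Icc 0 1 := by
      refine Set.inter_eq_right.2 fun x _ => ?_
      change 1 - |2 * x - 1| ≤ a
      linarith [abs_nonneg (2 * x - 1)]
    have h2 : Set.Iic a ∩ Set.Icc (0 : ℝ) 1 = Set.Icc 0 1 :=
      Set.inter_eq_right.2 fun x hx => hx.2.trans ha1
    rw [h1, h2]
  · have h1 : tent ⁻¹' Set.Iic a ∩ Set.Icc 0 1 = Set.Icc 0 (a / 2) ∪ Set.Icc (1 - a / 2) 1 := by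
      ext x
      simp only [Set.mem_inter_iff, Set.mem_preimage, Set.mem_Iic, Set.mem_Icc, Set.mem_union,
        tent]
      constructor
      · rintro ⟨h, h0, h1⟩
        have : 1 - a ≤ |2 * x - 1| := by linarith
        rcases le_abs.1 this with h | h
        · right; constructor <;> linarith
        · left; constructor <;> linarith
      · rintro (⟨h0, h1⟩ | ⟨h0, h1⟩)
        · refine ⟨?_, h0, by linarith⟩
          linarith [neg_abs_le (2 * x - 1)]
        · refine ⟨?_, by linarith, h1⟩
          linarith [le_abs_self (2 * x - 1)]
    have h2 : Set.Iic a ∩ Set.Icc (0 : ℝ) 1 = Set.Icc 0 a := by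
      ext x
      simp only [Set.mem_inter_iff, Set.mem_Iic, Set.mem_Icc]
      constructor
      · rintro ⟨h, h0, h1⟩; exact ⟨h0, h⟩
      · rintro ⟨h, h0⟩; exact ⟨h0, h, by linarith⟩
    rw [h1, h2, measure_union _ measurableSet_Icc, Real.volume_Icc, Real.volume_Icc,
      Real.volume_Icc, ← ENNReal.ofReal_add (by linarith) (by linarith)]
    · congr 1; ring
    · rw [Set.disjoint_left]
      rintro x ⟨h0, h1⟩ ⟨h2, h3⟩
      linarith

theorem cos_pi_mul_tent (x : ℝ) : Real.cos (Real.pi * tent x) = Real.cos (2 * Real.pi * x) := by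
  have h : Real.pi * tent x = Real.pi - |Real.pi * (2 * x - 1)| := by
    rw [abs_mul, abs_of_pos Real.pi_pos, tent]
    ring
  rw [h, Real.cos_pi_sub, Real.cos_abs, show Real.pi * (2 * x - 1) = 2 * Real.pi * x - Real.pi by
    ring, Real.cos_sub_pi, neg_neg]

theorem measurePreserving_tent_cube :
    MeasurePreserving (fun (x : Fin d → ℝ) j => tent (x j))
      (volume.restrict (Set.Icc (0 : Fin d → ℝ) 1))
      (volume.restrict (Set.Icc (0 : Fin d → ℝ) 1)) := by
  rw [volume_restrict_cube]
  exact measurePreserving_pi _ _ fun _ => measurePreserving_tent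

/-- The logarithm of the part of the symbol of `-Δ` that belongs to the directions in `S`. -/
noncomputable def logSymbol (S : Finset (Fin d)) (x : Fin d → ℝ) : ℝ :=
  Real.log (∑ j ∈ S, (1 - Real.cos (Real.pi * x j)))

theorem measurable_logSymbol (S : Finset (Fin d)) : Measurable (logSymbol S) := by
  unfold logSymbol
  refine Real.measurable_log.comp (Continuous.measurable ?_)
  fun_prop

/-- The logarithm of the modulus of a meromorphic function is interval integrable, which covers the
singularity at `0`. -/
theorem integrableOn_log_one_sub_cos :
    IntegrableOn (fun x : ℝ => Real.log (1 - Real.cos (Real.pi * x))) (Set.Icc 0 1) := by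
  rw [← intervalIntegrable_iff_integrableOn_Icc_of_le zero_le_one]
  have h : MeromorphicOn (fun x : ℝ => 1 - Real.cos (Real.pi * x)) (Set.uIcc 0 1) := by
    intro x _
    have : AnalyticAt ℝ (fun x : ℝ => 1 - Real.cos (Real.pi * x)) x := by fun_prop
    exact this.meromorphicAt
  simpa only [Real.norm_eq_abs, Real.log_abs] using h.intervalIntegrable_log_norm

theorem one_sub_cos_pos {x : ℝ} (h0 : 0 < x) (h1 : x ≤ 1) : 0 < 1 - Real.cos (Real.pi * x) := by
  have hpi := Real.pi_pos
  have := Real.strictAntiOn_cos (a := 0) (b := Real.pi * x) ⟨le_rfl, hpi.le⟩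
    ⟨by positivity, by nlinarith⟩ (by positivity)
  rw [Real.cos_zero] at this
  linarith

theorem sum_one_sub_cos_le (S : Finset (Fin d)) (x : Fin d → ℝ) :
    ∑ j ∈ S, (1 - Real.cos (Real.pi * x j)) ≤ 2 * S.card := by
  refine (Finset.sum_le_card_nsmul S _ 2 fun j _ => ?_).trans (by simp [mul_comm])
  linarith [Real.neg_one_le_cos (Real.pi * x j)]

theorem single_le_sum_one_sub_cos {S : Finset (Fin d)} {s : Fin d} (hs : s ∈ S)
    (x : Fin d → ℝ) :
    1 - Real.cos (Real.pi * x s) ≤ ∑ j ∈ S, (1 - Real.cos (Real.pi * x j)) :=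
  Finset.single_le_sum (f := fun j => 1 - Real.cos (Real.pi * x j))
    (fun j _ => by linarith [Real.cos_le_one (Real.pi * x j)]) hs

theorem abs_log_le_of_le_of_le {a b t : ℝ} (ha : 0 < a) (h1 : a ≤ t) (h2 : t ≤ b) :
    |Real.log t| ≤ |Real.log a| + |Real.log b| := by
  have h3 := Real.log_le_log ha h1
  have h4 := Real.log_le_log (ha.trans_le h1) h2
  rw [abs_le]
  constructor
  · linarith [neg_abs_le (Real.log a), abs_nonneg (Real.log b)]
  · linarith [le_abs_self (Real.log b), abs_nonneg (Real.log a)]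

/-- The sum lies between one of its terms and `2 * S.card`, so its logarithm is dominated by a
one-dimensional integrable function plus a constant. -/
theorem integrableOn_logSymbol {S : Finset (Fin d)} (hS : S.Nonempty) :
    IntegrableOn (logSymbol S) (Set.Icc 0 1) := by
  obtain ⟨s, hs⟩ := hS
  have h1 : Integrable (fun x : Fin d → ℝ => Real.log (1 - Real.cos (Real.pi * x s)))
      (volume.restrict (Set.Icc 0 1)) :=
    (measurePreserving_eval_cube s).integrable_comp_of_integrable integrableOn_log_one_sub_cos
  have hU : (Set.univ.pi fun _ => Set.Ioo 0 1) =ᵐ[volume] Set.Icc (0 : Fin d → ℝ) 1 :=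
    Measure.univ_pi_Ioo_ae_eq_Icc
  have hUm : MeasurableSet (Set.univ.pi fun _ : Fin d => Set.Ioo (0 : ℝ) 1) :=
    MeasurableSet.univ_pi fun _ => measurableSet_Ioo
  refine (h1.abs.add (integrable_const |Real.log (2 * S.card)|)).mono'
    (measurable_logSymbol S).aestronglyMeasurable ?_
  rw [← Measure.restrict_congr_set hU]
  refine (ae_restrict_iff' hUm).2 (Eventually.of_forall fun x hx => ?_)
  have hxs := hx s (Set.mem_univ s)
  exact abs_log_le_of_le_of_le (one_sub_cos_pos hxs.1 hxs.2.le) (single_le_sum_one_sub_cos hs x)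
    (sum_one_sub_cos_le S x)

theorem sum_one_sub_cos_pos {S : Finset (Fin d)} (hS : S.Nonempty) {x : Fin d → ℝ}
    (hx : ∀ j, 0 < x j ∧ x j ≤ 1) : 0 < ∑ j ∈ S, (1 - Real.cos (Real.pi * x j)) :=
  Finset.sum_pos (fun j _ => one_sub_cos_pos (hx j).1 (hx j).2) hS

/-- With argument `π x` each `1 - cos` increases on the unit interval, which is the monotonicity the
Riemann sum lemma needs; it would fail for `2 π x`. -/
theorem tendsto_sum_logSymbol {S : Finset (Fin d)} (hS : S.Nonempty) (c : ℝ) :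
    Tendsto (fun n : ℕ => (∑ k ∈ innerBox d n, (c + logSymbol S fun j => (k j : ℝ) / n)) /
      (n : ℝ) ^ d) atTop (𝓝 (c + ∫ x in Set.Icc 0 1, logSymbol S x)) := by
  have hI := integrableOn_logSymbol hS
  have hc : ∫ x in Set.Icc (0 : Fin d → ℝ) 1, (c + logSymbol S x) =
      c + ∫ x in Set.Icc 0 1, logSymbol S x := by
    rw [integral_add (integrable_const c) hI]
    simp
  rw [← hc]
  obtain ⟨o, -⟩ := id hS
  refine tendsto_riemann_sum o (C := c + |Real.log (2 * S.card)|)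
    ((integrable_const c).add hI) ?_ ?_ ?_
  · intro x y hx hxy hy
    have hpi := Real.pi_pos
    have hx1 : ∀ j, x j ≤ 1 := fun j => (hxy j).trans (hy j)
    refine add_le_add_right (Real.log_le_log (sum_one_sub_cos_pos hS fun j => ⟨hx j, hx1 j⟩)
      (Finset.sum_le_sum fun j _ => ?_)) c
    have := Real.strictAntiOn_cos.antitoneOn (a := Real.pi * x j) (b := Real.pi * y j)
      ⟨mul_nonneg hpi.le (hx j).le, by nlinarith [hx1 j]⟩
      ⟨mul_nonneg hpi.le ((hx j).le.trans (hxy j)), by nlinarith [hy j]⟩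
      (mul_le_mul_of_nonneg_left (hxy j) hpi.le)
    linarith
  · intro x
    refine add_le_add_right ?_ c
    -- The upper bound is required at every point, including zeros of the sum, where `Real.log 0 =
    -- 0`; the absolute value in `C` covers that case.
    rcases (Finset.sum_nonneg fun j (_ : j ∈ S) => show 0 ≤ 1 - Real.cos (Real.pi * x j) by
      linarith [Real.cos_le_one (Real.pi * x j)]).eq_or_lt with h | h
    · rw [logSymbol, ← h, Real.log_zero]
      positivity
    · exact (Real.log_le_log h (sum_one_sub_cos_le S x)).trans (le_abs_self _)
  · intro x hx
    have hpos := sum_one_sub_cos_pos hS fun j => ⟨(hx j).1, (hx j).2.le⟩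
    refine continuousAt_const.add (ContinuousAt.log (Continuous.continuousAt ?_) hpos.ne')
    fun_prop

theorem logSymbol_tent (S : Finset (Fin d)) (x : Fin d → ℝ) :
    logSymbol S (fun j => tent (x j)) =
      Real.log (∑ j ∈ S, (1 - Real.cos (2 * Real.pi * x j))) := by
  simp only [logSymbol, cos_pi_mul_tent]

theorem integrableOn_log_sum_one_sub_cos {S : Finset (Fin d)} (hS : S.Nonempty) :
    IntegrableOn (fun x : Fin d → ℝ => Real.log (∑ j ∈ S, (1 - Real.cos (2 * Real.pi * x j))))
      (Set.Icc 0 1) := by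
  simp only [← logSymbol_tent]
  exact measurePreserving_tent_cube.integrable_comp_of_integrable (integrableOn_logSymbol hS)

theorem integral_log_sum_one_sub_cos (S : Finset (Fin d)) :
    ∫ x in Set.Icc (0 : Fin d → ℝ) 1, Real.log (∑ j ∈ S, (1 - Real.cos (2 * Real.pi * x j))) =
      ∫ x in Set.Icc 0 1, logSymbol S x := by
  simp only [← logSymbol_tent]
  conv_rhs => rw [← (measurePreserving_tent_cube (d := d)).map_eq]
  rw [integral_map measurePreserving_tent_cube.measurable.aemeasurable
    (measurable_logSymbol S).aestronglyMeasurable]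

theorem integral_logSymbol_singleton (o : Fin d) :
    ∫ x in Set.Icc 0 1, logSymbol {o} x =
      ∫ x in (0 : ℝ)..1, Real.log (1 - Real.cos (2 * Real.pi * x)) := by
  rw [← integral_log_sum_one_sub_cos, intervalIntegral.integral_of_le zero_le_one,
    ← integral_Icc_eq_integral_Ioc]
  simp only [Finset.sum_singleton]
  rw [← (measurePreserving_eval_cube o).map_eq, integral_map
    (measurePreserving_eval_cube o).measurable.aemeasurable]
  refine Measurable.aestronglyMeasurable (Real.measurable_log.comp (Continuous.measurable ?_))
  fun_prop

theorem intervalIntegrable_log_one_sub_cos :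
    IntervalIntegrable (fun x : ℝ => Real.log (1 - Real.cos (2 * Real.pi * x))) volume 0 1 := by
  have h : MeromorphicOn (fun x : ℝ => 1 - Real.cos (2 * Real.pi * x)) (Set.uIcc 0 1) := by
    intro x _
    have : AnalyticAt ℝ (fun x : ℝ => 1 - Real.cos (2 * Real.pi * x)) x := by fun_prop
    exact this.meromorphicAt
  simpa only [Real.norm_eq_abs, Real.log_abs] using h.intervalIntegrable_log_norm

end Integrals

end LatticeMaxwell
namespace LatticeMaxwell

open Filter Topology

variable {d : ℕ}

/-! ### Boundary sites, edges and plaquettes. -/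

section Counting

/-- The sites with a coordinate in `{-1, 0, n}`. -/
noncomputable def slab (d n : ℕ) : Finset (Site d) :=
  (Fintype.piFinset fun _ => Finset.Icc (-1) (n : ℤ)).filter
    fun x => ∃ j, x j ∈ ({-1, 0, (n : ℤ)} : Finset ℤ)

theorem mem_slab {n : ℕ} {x : Site d} :
    x ∈ slab d n ↔ (∀ l, -1 ≤ x l ∧ x l ≤ n) ∧ ∃ j, x j = -1 ∨ x j = 0 ∨ x j = n := by
  simp [slab]

theorem card_slab_le (d n : ℕ) : (slab d n).card ≤ 3 * d * (n + 2) ^ (d - 1) := by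
  have hsub : slab d n ⊆ Finset.univ.biUnion fun j : Fin d => Fintype.piFinset fun l =>
      if l = j then ({-1, 0, (n : ℤ)} : Finset ℤ) else Finset.Icc (-1) (n : ℤ) := by
    intro x hx
    obtain ⟨h1, j, h2⟩ := mem_slab.1 hx
    refine Finset.mem_biUnion.2 ⟨j, Finset.mem_univ j, Fintype.mem_piFinset.2 fun l => ?_⟩
    split_ifs with h
    · subst h; simpa using h2
    · exact Finset.mem_Icc.2 (h1 l)
  refine (Finset.card_le_card hsub).trans (Finset.card_biUnion_le.trans ?_)
  refine (Finset.sum_le_card_nsmul Finset.univ _ (3 * (n + 2) ^ (d - 1)) fun j _ => ?_).trans ?_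
  · rw [Fintype.card_piFinset, ← Finset.mul_prod_erase Finset.univ _ (Finset.mem_univ j),
      if_pos rfl]
    refine Nat.mul_le_mul Finset.card_le_three (le_of_eq ?_)
    rw [Finset.prod_congr rfl (g := fun _ => n + 2), Finset.prod_const,
      Finset.card_erase_of_mem (Finset.mem_univ j), Finset.card_univ, Fintype.card_fin]
    intro l hl
    rw [if_neg (Finset.ne_of_mem_erase hl), Int.card_Icc]
    omega
  · rw [Finset.card_univ, Fintype.card_fin, smul_eq_mul]
    exact (by ring : _ = _).le

theorem outerPlaquettes_sdiff_subset (d n : ℕ) :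
    outerPlaquettes d n \ plaquettes d n ⊆ slab d n ×ˢ Finset.univ := by
  rintro ⟨x, j, k⟩ h
  obtain ⟨h1, h2⟩ := Finset.mem_sdiff.1 h
  simp only [outerPlaquettes, Finset.mem_filter, Finset.mem_product, Fintype.mem_piFinset,
    Finset.mem_Icc, Finset.mem_univ, and_true] at h1
  refine Finset.mem_product.2 ⟨mem_slab.2 ⟨h1.1, ?_⟩, Finset.mem_univ _⟩
  by_contra hcon
  push Not at hcon
  have hx : ∀ l, 1 ≤ x l ∧ x l < n := fun l => by
    have h3 : x l ≠ -1 ∧ x l ≠ 0 ∧ x l ≠ n := hcon l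
    have := h1.1 l
    omega
  have hne : j ≠ k := h1.2.ne
  have hadd : ∀ i, x + unit i ∈ box d n := fun i => mem_box.2 fun l => by
    have := hx l
    rw [Pi.add_apply, unit_apply]
    split_ifs <;> omega
  refine h2 (mem_plaquettes.2 ⟨mem_box.2 fun l => ?_, h1.2, hadd j, mem_box.2 fun l => ?_,
    hadd k⟩)
  · have := hx l
    omega
  · have := hx l
    rw [Pi.add_apply, Pi.add_apply, unit_apply, unit_apply]
    split_ifs with h3 h4
    · exact absurd (h3.symm.trans h4) hne
    all_goals omega

theorem modeBox_sdiff_innerBox_subset (n : ℕ) (i : Fin d) :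
    modeBox n i \ innerBox d n ⊆ slab d n := by
  intro x h
  obtain ⟨h1, h2⟩ := Finset.mem_sdiff.1 h
  rw [mem_modeBox] at h1
  refine mem_slab.2 ⟨fun l => by have := h1 l; omega, ?_⟩
  by_contra hcon
  push Not at hcon
  refine h2 (mem_innerBox.2 fun l => ?_)
  have := hcon l
  have := h1 l
  omega

/-- All edges in the last direction `o` belong to the tree, so the sets can differ only near the
boundary. -/
theorem axialEdges_sdiff_refEdges_subset (n : ℕ) {o : Fin d} (ho : ∀ k, ¬ o < k) :
    axialEdges d n \ refEdges n o ⊆ slab d n ×ˢ Finset.univ := by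
  rintro ⟨x, i⟩ h
  obtain ⟨h1, h2⟩ := Finset.mem_sdiff.1 h
  obtain ⟨h3, h4⟩ := Finset.mem_sdiff.1 h1
  have hio : i ≠ o := by
    rintro rfl
    exact h4 (mem_treeEdges.2 ⟨h3, fun k hk => absurd hk (ho k)⟩)
  obtain ⟨hx, hxi⟩ := mem_edges.1 h3
  rw [mem_box] at hx hxi
  have hxi := hxi i
  rw [Pi.add_apply, unit_apply, if_pos rfl] at hxi
  refine Finset.mem_product.2 ⟨mem_slab.2 ⟨fun l => ?_, ?_⟩, Finset.mem_univ _⟩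
  · have := hx l
    change -1 ≤ x l ∧ x l ≤ n
    omega
  · by_contra hcon
    push Not at hcon
    refine h2 (mem_refEdges.2 ⟨hio, mem_modeBox.2 fun l => ?_⟩)
    have h5 : x l ≠ -1 ∧ x l ≠ 0 ∧ x l ≠ n := hcon l
    have := hx l
    change 0 ≤ x l ∧ x l < n ∧ (l ≠ i → 1 ≤ x l)
    refine ⟨by omega, by omega, fun _ => by omega⟩

/-- A tree edge in direction `i ≠ o` has `x o = 0`, while the Dirichlet condition forces `x o ≥ 1`.
-/
theorem refEdges_subset_axialEdges (n : ℕ) {o : Fin d} (ho : ∀ k, k ≠ o → k < o) :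
    refEdges n o ⊆ axialEdges d n := by
  rintro ⟨x, i⟩ h
  obtain ⟨h1, h2⟩ := mem_refEdges.1 h
  refine Finset.mem_sdiff.2 ⟨refEdges_subset_edges n o h, fun ht => ?_⟩
  have h3 := (mem_treeEdges.1 ht).2 o (ho i h1)
  have h4 : o ≠ i → 1 ≤ x o := (mem_modeBox.1 h2 o).2.2
  have := h4 h1.symm
  omega

end Counting

/-! ### Boundary effects are of order `n^(d-1) log n`. -/

section Estimates

/-- An exponent that works for all polynomial bounds below. -/
def growthExponent (d : ℕ) : ℕ := 6 * d + 8

/-- The size of the boundary contributions. -/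
noncomputable def boundaryError (d n : ℕ) : ℝ :=
  (3 * d ^ 3 * (n + 2 : ℝ) ^ (d - 1)) * (growthExponent d * Real.log (n + 2))

theorem two_le_cast_add_two (n : ℕ) : (2 : ℝ) ≤ n + 2 := by
  have : (0 : ℝ) ≤ n := Nat.cast_nonneg n
  linarith

/-- As `n + 2 ≥ 2`, constants are absorbed into powers of `n + 2`, uniformly in `n`. -/
theorem cast_le_pow (d n : ℕ) : (d : ℝ) ≤ (n + 2 : ℝ) ^ d := by
  have h1 : (d : ℝ) ≤ 2 ^ d := by exact_mod_cast (Nat.lt_two_pow_self (n := d)).le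
  exact h1.trans (pow_le_pow_left₀ two_pos.le (two_le_cast_add_two n) d)

theorem pow_add_one_le (n k : ℕ) : (n + 2 : ℝ) ^ k + 1 ≤ (n + 2 : ℝ) ^ (k + 1) := by
  have h2 := two_le_cast_add_two n
  have h1 : (1 : ℝ) ≤ (n + 2 : ℝ) ^ k := one_le_pow₀ (by linarith)
  rw [pow_succ]
  nlinarith

theorem sixteen_le_pow (n : ℕ) : (16 : ℝ) ≤ (n + 2 : ℝ) ^ 4 := by
  have := pow_le_pow_left₀ two_pos.le (two_le_cast_add_two n) 4
  norm_num at this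
  exact this

theorem card_axialEdges_le (d n : ℕ) : ((axialEdges d n).card : ℝ) ≤ (n + 2 : ℝ) ^ (2 * d) := by
  have h : (axialEdges d n).card ≤ (n + 1) ^ d * d := by
    refine (Finset.card_le_card (t := box d n ×ˢ Finset.univ) fun e he => ?_).trans ?_
    · exact Finset.mem_product.2 ⟨mem_box_of_mem_edges (Finset.mem_sdiff.1 he).1,
        Finset.mem_univ _⟩
    · simp [box]
  have h' : ((axialEdges d n).card : ℝ) ≤ (n + 1 : ℝ) ^ d * d := by exact_mod_cast h
  have h0 : (0 : ℝ) ≤ n := Nat.cast_nonneg n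
  refine h'.trans ?_
  rw [two_mul, pow_add]
  refine mul_le_mul (pow_le_pow_left₀ (by positivity) (by linarith) d) (cast_le_pow d n)
    (by positivity) (by positivity)

theorem card_outerPlaquettes_le (d n : ℕ) :
    ((outerPlaquettes d n).card : ℝ) ≤ (n + 2 : ℝ) ^ (3 * d) := by
  have h : (outerPlaquettes d n).card ≤ (n + 2) ^ d * (d * d) := by
    refine (Finset.card_filter_le _ _).trans (le_of_eq ?_)
    have : ((n : ℤ) + 1 + 1).toNat = n + 2 := by omega
    simp [this]
  have h' : ((outerPlaquettes d n).card : ℝ) ≤ (n + 2 : ℝ) ^ d * (d * d) := by exact_mod_cast h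
  refine h'.trans ?_
  rw [show 3 * d = d + (d + d) by ring, pow_add _ d, pow_add _ d]
  gcongr <;> exact cast_le_pow d n

theorem one_div_spectralGap_le (d n : ℕ) :
    1 / spectralGap d n ≤ (n + 2 : ℝ) ^ (4 * d + 3) := by
  rw [spectralGap, one_div_one_div]
  refine le_trans ?_ (pow_add_one_le n (4 * d + 2))
  have h0 : (0 : ℝ) ≤ n := Nat.cast_nonneg n
  have h1 : (d * n : ℝ) ≤ (n + 2 : ℝ) ^ (d + 1) := by
    rw [pow_succ]
    exact mul_le_mul (cast_le_pow d n) (by linarith) h0 (by positivity)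
  have h2 : (d * n : ℝ) ^ 2 ≤ ((n + 2 : ℝ) ^ (d + 1)) ^ 2 :=
    pow_le_pow_left₀ (by positivity) h1 2
  have h3 := mul_le_mul (card_axialEdges_le d n) h2 (by positivity) (by positivity)
  rw [← pow_mul, ← pow_add] at h3
  rw [show 4 * d + 2 = 2 * d + (d + 1) * 2 by ring]
  linarith

theorem pow_le_pow_growthExponent (n : ℕ) {k : ℕ} (hk : k ≤ growthExponent d) :
    (n + 2 : ℝ) ^ k ≤ (n + 2 : ℝ) ^ growthExponent d :=
  pow_le_pow_right₀ (by linarith [two_le_cast_add_two n]) hk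

/-- This bound fixes `growthExponent`: `4` for the constant `16`, `2 d` for the edges, `4 d + 3` for
the gap and `1` for the summand `1`. -/
theorem perturbation_factor_le (d n : ℕ) :
    1 + 16 * (axialEdges d n).card / spectralGap d n ≤ (n + 2 : ℝ) ^ growthExponent d := by
  have h1 := mul_le_mul (sixteen_le_pow n) (card_axialEdges_le d n) (by positivity) (by positivity)
  have h2 := mul_le_mul h1 (one_div_spectralGap_le d n)
    (one_div_nonneg.2 (spectralGap_pos d n).le) (by positivity)
  rw [← pow_add, ← pow_add, mul_one_div] at h2
  have h3 := pow_add_one_le n (4 + 2 * d + (4 * d + 3))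
  rw [show 4 + 2 * d + (4 * d + 3) + 1 = growthExponent d by unfold growthExponent; ring] at h3
  linarith

theorem form_bound_le (d n : ℕ) :
    (16 * (outerPlaquettes d n).card * (axialEdges d n).card : ℝ) ≤
      (n + 2 : ℝ) ^ growthExponent d := by
  have h1 := mul_le_mul (sixteen_le_pow n) (card_outerPlaquettes_le d n) (by positivity)
    (by positivity)
  have h2 := mul_le_mul h1 (card_axialEdges_le d n) (by positivity) (by positivity)
  rw [← pow_add, ← pow_add] at h2
  refine h2.trans (pow_le_pow_growthExponent n ?_)
  unfold growthExponent
  omega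

theorem log_nonneg_cast_add_two (n : ℕ) : 0 ≤ Real.log (n + 2) :=
  Real.log_nonneg (by linarith [two_le_cast_add_two n])

theorem log_le_of_le_pow {t : ℝ} {n : ℕ} (ht : 0 < t) (h : t ≤ (n + 2 : ℝ) ^ growthExponent d) :
    Real.log t ≤ growthExponent d * Real.log (n + 2) := by
  rw [← Real.log_pow]
  exact Real.log_le_log ht h

theorem neg_log_spectralGap_le (d n : ℕ) :
    -Real.log (spectralGap d n) ≤ growthExponent d * Real.log (n + 2) := by
  rw [← Real.log_inv, ← one_div]
  refine log_le_of_le_pow (one_div_pos.2 (spectralGap_pos d n))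
    ((one_div_spectralGap_le d n).trans (pow_le_pow_growthExponent n ?_))
  unfold growthExponent
  omega

/-- The exponent `e` counts the directions attached to a site: two for plaquettes, one for edges,
none for frequencies. -/
theorem card_mul_le_boundaryError (hd : 0 < d) {n r e : ℕ} (he : e ≤ 2)
    (hr : r ≤ (slab d n).card * d ^ e) :
    (r : ℝ) * (growthExponent d * Real.log (n + 2)) ≤ boundaryError d n := by
  have hlog := log_nonneg_cast_add_two n
  refine mul_le_mul_of_nonneg_right ?_ (by positivity)
  have h1 : r ≤ 3 * d ^ 3 * (n + 2) ^ (d - 1) := by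
    refine hr.trans ((Nat.mul_le_mul (card_slab_le d n)
      (Nat.pow_le_pow_right hd he)).trans (le_of_eq ?_))
    ring
  exact_mod_cast h1

theorem boundaryError_nonneg (d n : ℕ) : 0 ≤ boundaryError d n := by
  have := log_nonneg_cast_add_two n
  unfold boundaryError
  positivity

theorem abs_log_det_sub_log_det_sigmaZero_le (hd : 0 < d) (n : ℕ) :
    |Real.log (gram (outerPlaquettes d n) (axialEdges d n)).det -
      Real.log (sigmaZero d n).det| ≤ boundaryError d n := by
  obtain ⟨-, h1, h2⟩ := gram_outerPlaquettes_bounds d n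
  have hpos := (sigmaZero_posDef d n).det_pos
  have hf : 0 < 1 + 16 * (axialEdges d n).card / spectralGap d n := by
    have := spectralGap_pos d n
    positivity
  have h3 := Real.log_le_log hpos h1
  have h4 := Real.log_le_log (hpos.trans_le h1) h2
  rw [Real.log_mul hpos.ne' (pow_pos hf _).ne', Real.log_pow] at h4
  have h5 := mul_le_mul_of_nonneg_left (log_le_of_le_pow hf (perturbation_factor_le d n))
    (Nat.cast_nonneg (outerPlaquettes d n \ plaquettes d n).card)
  have h6 : ((outerPlaquettes d n \ plaquettes d n).card : ℝ) *
      (growthExponent d * Real.log (n + 2)) ≤ boundaryError d n := by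
    refine card_mul_le_boundaryError hd le_rfl
      ((Finset.card_le_card (outerPlaquettes_sdiff_subset d n)).trans (le_of_eq ?_))
    simp [sq]
  rw [abs_le]
  constructor <;> linarith [boundaryError_nonneg d n]

theorem abs_log_det_sub_log_det_refEdges_le (hd : 0 < d) (n : ℕ) {o : Fin d}
    (ho : ∀ k, k ≠ o → k < o) :
    |Real.log (gram (outerPlaquettes d n) (axialEdges d n)).det -
      Real.log (gram (outerPlaquettes d n) (refEdges n o)).det| ≤ boundaryError d n := by
  obtain ⟨hpos, h1, h2⟩ := det_gram_subset_bounds (refEdges_subset_axialEdges n ho)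
  set r := (axialEdges d n \ refEdges n o).card with hr
  have hgap := spectralGap_pos d n
  have hN : (0 : ℝ) < (n + 2 : ℝ) ^ growthExponent d := by positivity
  have h1' := Real.log_le_log (mul_pos (pow_pos hgap _) hpos) h1
  rw [Real.log_mul (pow_pos hgap _).ne' hpos.ne', Real.log_pow] at h1'
  have h2' := Real.log_le_log ((mul_pos (pow_pos hgap _) hpos).trans_le h1)
    (h2.trans (mul_le_mul_of_nonneg_right
      (pow_le_pow_left₀ (by positivity) (form_bound_le d n) r) hpos.le))
  rw [Real.log_mul (pow_pos hN _).ne' hpos.ne', Real.log_pow, Real.log_pow] at h2'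
  have h5 := mul_le_mul_of_nonneg_left (neg_log_spectralGap_le d n) (Nat.cast_nonneg r)
  have h6 : (r : ℝ) * (growthExponent d * Real.log (n + 2)) ≤ boundaryError d n := by
    refine card_mul_le_boundaryError hd one_le_two
      ((Finset.card_le_card (axialEdges_sdiff_refEdges_subset n fun k hk => ?_)).trans
        (le_of_eq ?_))
    · exact absurd (ho k hk.ne') hk.not_gt
    · simp
  rw [abs_le]
  constructor <;> linarith

theorem symbol_eq (n : ℕ) (k : Site d) :
    symbol n k = 2 * ∑ l, (1 - Real.cos (Real.pi * ((k l : ℝ) / n))) := by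
  rw [symbol, Finset.mul_sum]
  exact Finset.sum_congr rfl fun l _ => freq_sq _

theorem abs_log_symbol_le {n : ℕ} {k : Site d} {o : Fin d} (h1 : 1 ≤ k o) (h2 : k o < n) :
    |Real.log (symbol n k)| ≤ growthExponent d * Real.log (n + 2) := by
  have hpos := symbol_pos h1 h2
  have hn : (0 : ℝ) < n := by exact_mod_cast (show 0 < (n : ℤ) by omega)
  have h1' : (1 : ℝ) ≤ k o := by exact_mod_cast h1
  have h2' : (k o : ℝ) < n := by exact_mod_cast h2
  have hpi := Real.pi_pos
  have hup : symbol n k ≤ (n + 2 : ℝ) ^ growthExponent d := by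
    have h3 := sum_one_sub_cos_le Finset.univ fun l => (k l : ℝ) / n
    rw [Finset.card_univ, Fintype.card_fin] at h3
    have h4 : (4 : ℝ) ≤ (n + 2 : ℝ) ^ 2 := by nlinarith
    have h5 := mul_le_mul h4 (cast_le_pow d n) (by positivity) (by positivity)
    rw [← pow_add] at h5
    have h6 := pow_le_pow_growthExponent (d := d) n (k := 2 + d)
      (by unfold growthExponent; omega)
    rw [symbol_eq]
    linarith
  have hlow : (symbol n k)⁻¹ ≤ (n + 2 : ℝ) ^ growthExponent d := by
    -- From `cos t ≤ 1 - 2 t² / π²` for `|t| ≤ π`, applied in the direction `o` where the frequency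
    -- is at least `1`.
    have h3 : 4 / (n : ℝ) ^ 2 ≤ symbol n k := by
      refine le_trans ?_ (freq_sq_le_symbol k o)
      have hx : |Real.pi * ((k o : ℝ) / n)| ≤ Real.pi := by
        rw [abs_of_nonneg (by positivity)]
        have : (k o : ℝ) / n ≤ 1 := (div_le_one hn).2 h2'.le
        nlinarith
      have h4 := Real.cos_le_one_sub_mul_cos_sq hx
      have h5 : 2 / Real.pi ^ 2 * (Real.pi * ((k o : ℝ) / n)) ^ 2 = 2 * (k o : ℝ) ^ 2 / n ^ 2 := by
        field_simp
      rw [freq_sq]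
      have h6 : 2 / (n : ℝ) ^ 2 ≤ 2 * (k o : ℝ) ^ 2 / n ^ 2 := by
        gcongr
        nlinarith
      have h7 : 4 / (n : ℝ) ^ 2 = 2 * (2 / (n : ℝ) ^ 2) := by ring
      linarith
    have h4 : (symbol n k)⁻¹ ≤ (n : ℝ) ^ 2 := by
      refine (inv_anti₀ (by positivity) h3).trans ?_
      rw [inv_div]
      nlinarith [sq_nonneg (n : ℝ)]
    have h5 := pow_le_pow_growthExponent (d := d) n (k := 2) (by unfold growthExponent; omega)
    nlinarith
  rw [abs_le]
  constructor
  · have := log_le_of_le_pow (inv_pos.2 hpos) hlow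
    rw [Real.log_inv] at this
    linarith
  · exact log_le_of_le_pow hpos hup

theorem abs_sum_modeBox_sub_sum_innerBox_le (hd : 0 < d) (n : ℕ) {i o : Fin d} (hi : i ≠ o) :
    |∑ k ∈ modeBox n i, Real.log (symbol n k) - ∑ k ∈ innerBox d n, Real.log (symbol n k)| ≤
      boundaryError d n := by
  rw [← Finset.sum_sdiff (innerBox_subset_modeBox i), add_sub_cancel_right]
  refine (Finset.abs_sum_le_sum_abs _ _).trans ((Finset.sum_le_card_nsmul _ _
    (growthExponent d * Real.log (n + 2)) fun k hk => ?_).trans ?_)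
  · have := mem_modeBox.1 (Finset.mem_sdiff.1 hk).1 o
    exact abs_log_symbol_le (this.2.2 hi.symm) this.2.1
  · rw [nsmul_eq_mul]
    refine card_mul_le_boundaryError hd (Nat.zero_le 2)
      ((Finset.card_le_card (modeBox_sdiff_innerBox_subset n i)).trans (le_of_eq ?_))
    simp

theorem tendsto_boundaryError_div (hd : 0 < d) :
    Tendsto (fun n : ℕ => boundaryError d n / (n : ℝ) ^ d) atTop (𝓝 0) := by
  have hN : Tendsto (fun n : ℕ => (n : ℝ) + 2) atTop atTop :=
    tendsto_atTop_add_const_right _ _ tendsto_natCast_atTop_atTop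
  have h1 : Tendsto (fun n : ℕ => Real.log (n + 2) / ((n : ℝ) + 2)) atTop (𝓝 0) :=
    (Real.isLittleO_log_id_atTop.tendsto_div_nhds_zero).comp hN
  have h2 : Tendsto (fun n : ℕ => ((n : ℝ) + 2) / n) atTop (𝓝 1) := by
    have h : Tendsto (fun n : ℕ => 1 + 2 / (n : ℝ)) atTop (𝓝 (1 + 0)) :=
      tendsto_const_nhds.add (tendsto_const_div_atTop_nhds_zero_nat 2)
    rw [add_zero] at h
    refine h.congr' ?_
    filter_upwards [eventually_gt_atTop 0] with n hn
    have : (n : ℝ) ≠ 0 := by exact_mod_cast hn.ne'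
    field_simp
  have h3 := ((h2.pow d).mul h1).const_mul (3 * (d : ℝ) ^ 3 * growthExponent d)
  rw [mul_zero, mul_zero] at h3
  refine h3.congr' ?_
  filter_upwards [eventually_gt_atTop 0] with n hn
  have hn0 : (n : ℝ) ≠ 0 := by exact_mod_cast hn.ne'
  have hn2 : (n : ℝ) + 2 ≠ 0 := by positivity
  obtain ⟨m, rfl⟩ : ∃ m, d = m + 1 := ⟨d - 1, by omega⟩
  rw [boundaryError, Nat.add_sub_cancel, div_pow, pow_succ ((n : ℝ) + 2) m]
  field_simp

theorem tendsto_div_of_abs_sub_le (hd : 0 < d) {u v : ℕ → ℝ} {L : ℝ}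
    (huv : ∀ n, |u n - v n| ≤ boundaryError d n)
    (hv : Tendsto (fun n : ℕ => v n / (n : ℝ) ^ d) atTop (𝓝 L)) :
    Tendsto (fun n : ℕ => u n / (n : ℝ) ^ d) atTop (𝓝 L) := by
  have h : Tendsto (fun n : ℕ => (u n - v n) / (n : ℝ) ^ d) atTop (𝓝 0) := by
    refine squeeze_zero_norm (fun n => ?_) (tendsto_boundaryError_div hd)
    rw [norm_div, Real.norm_eq_abs, Real.norm_of_nonneg (by positivity)]
    exact div_le_div_of_nonneg_right (huv n) (by positivity)
  have := h.add hv
  rw [zero_add] at this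
  refine this.congr fun n => ?_
  ring

end Estimates

/-! ### The limit of the free energy. -/

section Limits

open MeasureTheory

theorem tendsto_sum_innerBox_log_symbol (o : Fin d) :
    Tendsto (fun n : ℕ => (∑ k ∈ innerBox d n, Real.log (symbol n k)) / (n : ℝ) ^ d) atTop
      (𝓝 (Real.log 2 + ∫ x in Set.Icc 0 1, logSymbol (Finset.univ : Finset (Fin d)) x)) := by
  refine (tendsto_sum_logSymbol ⟨o, Finset.mem_univ o⟩ (Real.log 2)).congr fun n => ?_
  congr 1
  refine Finset.sum_congr rfl fun k hk => ?_
  have h := symbol_pos (mem_innerBox.1 hk o).1 (mem_innerBox.1 hk o).2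
  rw [symbol_eq] at h ⊢
  rw [Real.log_mul two_ne_zero (pos_of_mul_pos_right h two_pos.le).ne', logSymbol]

theorem tendsto_sum_innerBox_log_freq (o : Fin d) :
    Tendsto (fun n : ℕ => (∑ k ∈ innerBox d n, Real.log (freq n (k o) ^ 2)) / (n : ℝ) ^ d) atTop
      (𝓝 (Real.log 2 + ∫ x in Set.Icc 0 1, logSymbol {o} x)) := by
  refine (tendsto_sum_logSymbol (Finset.singleton_nonempty o) (Real.log 2)).congr fun n => ?_
  congr 1
  refine Finset.sum_congr rfl fun k hk => ?_
  have h := pow_pos (freq_pos (mem_innerBox.1 hk o).1 (mem_innerBox.1 hk o).2) 2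
  rw [freq_sq] at h ⊢
  rw [Real.log_mul two_ne_zero (pos_of_mul_pos_right h two_pos.le).ne', logSymbol,
    Finset.sum_singleton]

/-- The `d - 1` components share one limit, since their frequency sets differ from `innerBox` only
in the slab. The last bracket comes from the Weinstein–Aronszajn factor. -/
theorem tendsto_log_det_gram_refEdges (hd : 0 < d) (o : Fin d) :
    Tendsto (fun n : ℕ =>
        Real.log (gram (outerPlaquettes d n) (refEdges n o)).det / (n : ℝ) ^ d) atTop
      (𝓝 (((d : ℝ) - 1) * (Real.log 2 +
          ∫ x in Set.Icc 0 1, logSymbol (Finset.univ : Finset (Fin d)) x) +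
        ((Real.log 2 + ∫ x in Set.Icc 0 1, logSymbol {o} x) -
          (Real.log 2 + ∫ x in Set.Icc 0 1, logSymbol (Finset.univ : Finset (Fin d)) x)))) := by
  have h1 : Tendsto (fun n : ℕ => ∑ i ∈ Finset.univ.erase o,
      (∑ k ∈ modeBox n i, Real.log (symbol n k)) / (n : ℝ) ^ d) atTop
      (𝓝 (∑ _i ∈ Finset.univ.erase o, (Real.log 2 +
        ∫ x in Set.Icc 0 1, logSymbol (Finset.univ : Finset (Fin d)) x))) :=
    tendsto_finsetSum _ fun i hi => tendsto_div_of_abs_sub_le hd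
      (fun n => abs_sum_modeBox_sub_sum_innerBox_le hd n (Finset.ne_of_mem_erase hi))
      (tendsto_sum_innerBox_log_symbol o)
  rw [Finset.sum_const, Finset.card_erase_of_mem (Finset.mem_univ o), Finset.card_univ,
    Fintype.card_fin, nsmul_eq_mul, Nat.cast_sub hd, Nat.cast_one] at h1
  refine (h1.add ((tendsto_sum_innerBox_log_freq o).sub
    (tendsto_sum_innerBox_log_symbol o))).congr fun n => ?_
  rw [log_det_gram_refEdges, add_div, sub_div, Finset.sum_div (Finset.univ.erase o)]

theorem exists_last (hd : 0 < d) : ∃ o : Fin d, ∀ k, k ≠ o → k < o := by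
  refine ⟨⟨d - 1, by omega⟩, fun k hk => ?_⟩
  have h1 : (k : ℕ) ≠ d - 1 := fun h => hk (Fin.ext h)
  rw [Fin.lt_def]
  have := k.2
  change (k : ℕ) < d - 1
  omega

/-- The value of the constant `K_d`. -/
noncomputable def constantValue (d : ℕ) : ℝ :=
  -(((d : ℝ) - 1) / 2) * Real.log 2
    - (1 / 2 : ℝ) * (∫ x in (0 : ℝ)..1, Real.log (1 - Real.cos (2 * Real.pi * x)))
    - (((d : ℝ) - 2) / 2) *
      (∫ x in Set.Icc (0 : Fin d → ℝ) 1,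
        Real.log (∑ k : Fin d, (1 - Real.cos (2 * Real.pi * x k))))

theorem tendsto_neg_half_log_det_gram (hd : 0 < d) :
    Tendsto (fun n : ℕ => -(1 / (2 * (n : ℝ) ^ d)) *
        Real.log (gram (outerPlaquettes d n) (axialEdges d n)).det) atTop
      (𝓝 (constantValue d)) := by
  obtain ⟨o, ho⟩ := exists_last hd
  have h := (tendsto_div_of_abs_sub_le hd (fun n => abs_log_det_sub_log_det_refEdges_le hd n ho)
    (tendsto_log_det_gram_refEdges hd o)).const_mul (-(1 / 2 : ℝ))
  -- Passes from half to full periods of the cosine; the integral of a function of `x o` alone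
  -- reduces to one dimension.
  rw [integral_logSymbol_singleton, ← integral_log_sum_one_sub_cos] at h
  convert h using 2
  · rw [← div_div]
    ring
  · rw [constantValue]
    ring

theorem tendsto_maxwellFreeEnergy (hd : 0 < d) :
    Tendsto (fun n : ℕ => maxwellFreeEnergy d n) atTop (𝓝 (constantValue d)) := by
  have h0 : Tendsto (fun n : ℕ =>
      Real.log (gram (outerPlaquettes d n) (axialEdges d n)).det / (n : ℝ) ^ d) atTop
      (𝓝 (-2 * constantValue d)) := by
    refine ((tendsto_neg_half_log_det_gram hd).const_mul (-2)).congr fun n => ?_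
    rw [← div_div]
    ring
  have h := (tendsto_div_of_abs_sub_le hd (u := fun n => Real.log (sigmaZero d n).det)
    (fun n => by
      rw [abs_sub_comm]
      exact abs_log_det_sub_log_det_sigmaZero_le hd n) h0).const_mul (-(1 / 2 : ℝ))
  convert h using 2
  · rw [maxwellFreeEnergy, trLog_sigmaZero, neg_div, mul_comm 2, ← div_div]
    ring
  · ring

theorem K_eq_constantValue (hd : 0 < d) : K d = constantValue d :=
  (tendsto_maxwellFreeEnergy hd).limUnder_eq

end Limits

end LatticeMaxwell

theorem theorem1p2 (d : ℕ) (hd : 2 ≤ d) :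
    -- `Q_d` defines a non-negative symmetric quadratic form, given by the curl
    (∀ v w : LatticeMaxwell.Fields d,
      inner ℝ v (LatticeMaxwell.Q d w) = inner ℝ (LatticeMaxwell.Q d v) w) ∧
    (∀ w : LatticeMaxwell.Fields d, 0 ≤ inner ℝ w (LatticeMaxwell.Q d w)) ∧
    (∀ w : LatticeMaxwell.Fields d,
      inner ℝ w (LatticeMaxwell.Q d w) =
        (1 / 2 : ℝ) * ∑ i : Fin d, ∑ j : Fin d,
          ‖LatticeMaxwell.partialD i (w j) - LatticeMaxwell.partialD j (w i)‖ ^ 2) ∧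
    -- the operators whose logarithms are taken are positive definite
    (∀ n : ℕ, (LatticeMaxwell.sigmaZero d n).PosDef) ∧
    (∀ n : ℕ, ∀ w ∈ LatticeMaxwell.axialSpace d n, w ≠ 0 →
      0 < inner ℝ w (LatticeMaxwell.Q d w)) ∧
    -- the limit that defines `K_d` exists
    Filter.Tendsto (fun n : ℕ => LatticeMaxwell.maxwellFreeEnergy d n) Filter.atTop
      (nhds (LatticeMaxwell.K d)) ∧
    -- `K_d` in terms of `Q_d`
    Filter.Tendsto
      (fun n : ℕ =>
        -(1 / (2 * (n : ℝ) ^ d)) *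
          LatticeMaxwell.trLog
            (LatticeMaxwell.compression (LatticeMaxwell.axialSpace d n) (LatticeMaxwell.Q d)))
      Filter.atTop (nhds (LatticeMaxwell.K d)) ∧
    -- the explicit formula, in which both integrals converge absolutely
    IntervalIntegrable (fun x : ℝ => Real.log (1 - Real.cos (2 * Real.pi * x)))
      MeasureTheory.volume 0 1 ∧
    MeasureTheory.IntegrableOn
      (fun x : Fin d → ℝ => Real.log (∑ k : Fin d, (1 - Real.cos (2 * Real.pi * x k))))
      (Set.Icc (0 : Fin d → ℝ) 1) MeasureTheory.volume ∧
    LatticeMaxwell.K d =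
      -(((d : ℝ) - 1) / 2) * Real.log 2
        - (1 / 2 : ℝ) * (∫ x in (0 : ℝ)..1, Real.log (1 - Real.cos (2 * Real.pi * x)))
        - (((d : ℝ) - 2) / 2) *
          (∫ x in Set.Icc (0 : Fin d → ℝ) 1,
            Real.log (∑ k : Fin d, (1 - Real.cos (2 * Real.pi * x k)))) := by
  have hd0 : 0 < d := by omega
  have hne : (Finset.univ : Finset (Fin d)).Nonempty := ⟨⟨0, hd0⟩, Finset.mem_univ _⟩
  refine ⟨LatticeMaxwell.Q_symmetric, fun w => ?_, LatticeMaxwell.inner_self_Q,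
    LatticeMaxwell.sigmaZero_posDef d, fun n w => LatticeMaxwell.inner_Q_pos_of_mem_axialSpace,
    ?_, ?_, LatticeMaxwell.intervalIntegrable_log_one_sub_cos,
    LatticeMaxwell.integrableOn_log_sum_one_sub_cos hne, LatticeMaxwell.K_eq_constantValue hd0⟩
  · rw [LatticeMaxwell.inner_self_Q]
    positivity
  · rw [LatticeMaxwell.K_eq_constantValue hd0]
    exact LatticeMaxwell.tendsto_maxwellFreeEnergy hd0
  · rw [LatticeMaxwell.K_eq_constantValue hd0]
    simp only [LatticeMaxwell.trLog_compression]
    exact LatticeMaxwell.tendsto_neg_half_log_det_gram hd0
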